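/- Let $X$ be a finite alphabet with $|X|\ge 2$, let $X^*$ be the set of finite words and $X^\omega$ the set of (right) infinite words over $X$, and let $K$ be a field. Let $G$ be a self-similar group over $X$: a group acting faithfully on $X^*$ by length-preserving permutations such that for all $g\in G$, $x\in X$ there is $g|_x\in G$ with $g(xw)=g(x)\,g|_x(w)$ for all $w\in X^*$; put $g|_{xw}=(g|_x)|_w$ for words. The group $G$ acts on $X^\omega$ by $g(x_1x_2x_3\cdots)=g(x_1)\,g|_{x_1}(x_2)\,g|_{x_1x_2}(x_3)\cdots$. Let $S$ be the associated inverse semigroup. It consists of $0$ and the elements $ugv^*$ with $u,v\in X^*$, $g\in G$ (uniquely written so), and its product is determined by $g\cdot h=gh$, $g^*=g^{-1}$, $gx=g(x)g|_x$ and $x^*y=\delta_{x,y}$ for $g,h\in G$, $x,y\in X$, the identity of $G$ and the empty word being the identity of $S$. Let $E(S)$ be its set of idempotents, with $f\le e$ if and only if $fe=f$. Let $K_0S$ be the contracted semigroup algebra: the $K$-algebra with basis $S\setminus\{0\}$ whose multiplication extends that of $S$, the zeroes of $S$ and $K$ being identified. - A finite set $F\subseteq E(S)$ covers $e\in E(S)$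 if $f\le e$ for all $f\in F$ and for every $f'\in E(S)$ with $0\ne f'\le e$ there is $f\in F$ with $f'f\neq 0$. The tight ideal $\mathrm{Tight}$ of $K_0S$ is the ideal generated by all products $\prod_{f\in F}(e-f)$ with $e\in E(S)$ and $F$ a finite cover of $e$ (the empty product being $e$). - $\mathrm{Sing}\subseteq K_0S$, the singular ideal, is the set of all $a\in K_0S$ such that for every $0\ne e\in E(S)$ there is $f\in E(S)$ with $0\neq f\le e$ and $af=0$. - The Nekrashevych algebra $\mathcal N$ of $(G,X)$ over $K$ is the unital $*$-algebra over $K$ (with trivial involution on $K$) generated by $X\cup G$, the identity of $G$ being the identity of the algebra, with relations $g^*=g^{-1}$, $g\cdot h=gh$, $gx=g(x)g|_x$, $y^*x=\delta_{x,y}$ for $g,h\in G$, $x,y\in X$, and $\sum_{x\in X}xx^*=1$. - $S$ acts on $X^\omega$ by partial maps, $ugv^*$ mapping $vw$ to $ug(w)$ for $w\in X^\omega$ and being undefined on words without prefix $v$. This gives a representation of $K_0S$ on the vector space $KX^\omega$ with basis $X^\omega$ (undefined values being replaced by $0$), and likewise a representation of $\mathcal N$ on $KX^\omega$, in which the generators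 $x$, $x^*$, $g$ act by the corresponding partial maps. Theorem. The kernel of the representation of $K_0S$ on $KX^\omega$ is $\mathrm{Sing}$. The canonical homomorphism $K_0S\to\mathcal N$, $ugv^*\mapsto ugv^*$, is surjective with kernel $\mathrm{Tight}$, and the representation of $\mathcal N$ on $KX^\omega$ composed with it is that of $K_0S$. Moreover $\mathrm{Tight}\subseteq\mathrm{Sing}$, and under the resulting identification $\mathcal N=K_0S/\mathrm{Tight}$ the kernel of the representation of $\mathcal N$ on $KX^\omega$ is $\mathrm{Sing}/\mathrm{Tight}$. Consequently $\mathcal N$ is simple (that is, nonzero with no two-sided ideals other than $0$ and $\mathcal N$) if and only if its representation on $KX^\omega$ is faithful. -/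

import Mathlib

noncomputable section

namespace Nekrashevych

/-! ### Self-similar groups -/

/-- A self-similar group over the alphabet `X`: a group `G` with a faithful, length-preserving
action on the words over `X` such that for all `g : G` and `x : X` there is a section
`g|ₓ : G` with `g (x w) = g (x) g|ₓ (w)` for all words `w`. -/
class SelfSimilarGroup (G X : Type*) [Group G] extends MulAction G (List X) where
  faithful : ∀ g h : G, (∀ w : List X, g • w = h • w) → g = h
  length_smul : ∀ (g : G) (w : List X), (g • w).length = w.length
  exists_section : ∀ (g : G) (x : X), ∃ h : G, ∀ w : List X, g • (x :: w) = g • [x] ++ h • w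

section Sections

variable {G X : Type*} [Group G] [SelfSimilarGroup G X]

open SelfSimilarGroup

theorem smul_singleton_ne_nil (g : G) (x : X) : g • [x] ≠ [] := by
  intro h
  have := length_smul g [x]
  simp [h] at this

/-- The letter `g (x)`. -/
def letter (g : G) (x : X) : X := (g • [x]).head (smul_singleton_ne_nil g x)

theorem smul_singleton (g : G) (x : X) : g • [x] = [letter g x] := by
  have h := length_smul g [x]
  obtain ⟨y, hy⟩ := List.length_eq_one_iff.1 (by simpa using h)
  simp [letter, hy]

/-- The section `g|ₓ` of `g` at the letter `x`. -/
def sec (g : G) (x : X) : G := (exists_section g x).choose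

theorem smul_cons (g : G) (x : X) (w : List X) : g • (x :: w) = letter g x :: sec g x • w := by
  have h := (exists_section g x).choose_spec w
  exact h.trans (congrArg (· ++ sec g x • w) (smul_singleton g x))

/-- The section `g|_w` of `g` at the word `w`. -/
def secW : G → List X → G
  | g, [] => g
  | g, x :: w => secW (sec g x) w

theorem smul_nil (g : G) : g • ([] : List X) = [] :=
  List.length_eq_zero_iff.1 (by simp [length_smul])

theorem smul_append (g : G) (u v : List X) : g • (u ++ v) = g • u ++ secW g u • v := by
  induction u generalizing g with
  | nil => simp [smul_nil, secW]
  | cons x u ih => simp [smul_cons, secW, ih]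

theorem secW_append (g : G) (u v : List X) : secW g (u ++ v) = secW (secW g u) v := by
  induction u generalizing g with
  | nil => rfl
  | cons x u ih => simp [secW, ih]

theorem secW_mul (g h : G) (w : List X) : secW (g * h) w = secW g (h • w) * secW h w := by
  apply faithful (X := X)
  intro v
  have h1 : (g * h) • (w ++ v) = g • h • (w ++ v) := mul_smul g h (w ++ v)
  rw [smul_append, smul_append, smul_append, mul_smul] at h1
  rw [mul_smul]
  exact List.append_cancel_left h1

theorem secW_one (w : List X) : secW (1 : G) w = 1 := by
  apply faithful (X := X)
  intro v
  have h1 : (1 : G) • (w ++ v) = w ++ v := one_smul G (w ++ v)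
  rw [smul_append, one_smul] at h1
  rw [one_smul]
  exact List.append_cancel_left h1

theorem secW_inv_mul (g : G) (w : List X) : secW g (g⁻¹ • w) = (secW g⁻¹ w)⁻¹ := by
  rw [eq_inv_iff_mul_eq_one, ← secW_mul, mul_inv_cancel, secW_one]

/-- The action of `g` on infinite words,
`g (x₁ x₂ x₃ ⋯) = g (x₁) g|_{x₁} (x₂) g|_{x₁ x₂} (x₃) ⋯`. -/
def omegaAct (g : G) (w : Stream' X) : Stream' X := fun n => letter (secW g (w.take n)) (w.get n)

theorem smul_take (g : G) (w : Stream' X) (n : ℕ) : g • w.take n = (omegaAct g w).take n := by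
  induction n with
  | zero => simp [smul_nil]
  | succ n ih =>
    rw [Stream'.take_succ', Stream'.take_succ', smul_append, smul_singleton, ih]
    rfl

theorem omegaAct_one (w : Stream' X) : omegaAct (1 : G) w = w := by
  apply Stream'.take_theorem
  intro n
  rw [← smul_take, one_smul]

theorem omegaAct_mul (g h : G) (w : Stream' X) :
    omegaAct (g * h) w = omegaAct g (omegaAct h w) := by
  apply Stream'.take_theorem
  intro n
  rw [← smul_take, ← smul_take, ← smul_take, mul_smul]

theorem omegaAct_cons (g : G) (x : X) (w : Stream' X) :
    omegaAct g (Stream'.cons x w) = Stream'.cons (letter g x) (omegaAct (sec g x) w) := by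
  funext n
  cases n <;> rfl

theorem omegaAct_append (g : G) (u : List X) (w : Stream' X) :
    omegaAct g (u ++ₛ w) = (g • u) ++ₛ omegaAct (secW g u) w := by
  induction u generalizing g with
  | nil => simp [smul_nil, secW]
  | cons x u ih =>
    rw [Stream'.cons_append_stream, omegaAct_cons, ih, smul_cons, Stream'.cons_append_stream, secW]

end Sections

/-! ### The associated inverse semigroup -/

/-- The inverse semigroup `S` of the self-similar group, whose elements are `0` and the elements
`mk u g v`, standing for `u g v*` with `u, v` words and `g : G`. -/
inductive InvSemi (G X : Type*) : Type _
  | zero : InvSemi G X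
  | mk (u : List X) (g : G) (v : List X) : InvSemi G X

section InvSemigroup

variable {G X : Type*} [Group G] [SelfSimilarGroup G X]

open SelfSimilarGroup

open scoped Classical in
/-- The product `(u g v*) (u' g' v'*)`:
if `u' = v z`, then `v* u' = z` and the product is `(u g(z)) (g|_z g') v'*`;
if `v = u' z`, then `v* u' = z*`, and the product is `u (g k⁻¹) (v' g'⁻¹(z))*` where
`k = g'⁻¹|_z`; otherwise it is `0`. -/
def InvSemi.mul : InvSemi G X → InvSemi G X → InvSemi G X
  | .mk u g v, .mk u' g' v' =>
    if v <+: u' then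
      .mk (u ++ g • u'.drop v.length) (secW g (u'.drop v.length) * g') v'
    else if u' <+: v then
      .mk u (g * (secW g'⁻¹ (v.drop u'.length))⁻¹) (v' ++ g'⁻¹ • v.drop u'.length)
    else .zero
  | _, _ => .zero

instance : Mul (InvSemi G X) := ⟨InvSemi.mul⟩

theorem zero_mul_aux (s : InvSemi G X) : InvSemi.zero * s = InvSemi.zero := rfl

theorem mul_zero_aux (s : InvSemi G X) : s * InvSemi.zero = InvSemi.zero := by
  cases s <;> rfl

theorem mk_mul_mk_left (u : List X) (g : G) (v z : List X) (g' : G) (v' : List X) :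
    InvSemi.mk u g v * InvSemi.mk (v ++ z) g' v' =
      InvSemi.mk (u ++ g • z) (secW g z * g') v' := by
  change InvSemi.mul _ _ = _
  simp [InvSemi.mul]

theorem mk_mul_mk_right (u : List X) (g : G) (u' z : List X) (g' : G) (v' : List X) :
    InvSemi.mk u g (u' ++ z) * InvSemi.mk u' g' v' =
      InvSemi.mk u (g * (secW g'⁻¹ z)⁻¹) (v' ++ g'⁻¹ • z) := by
  by_cases hz : z = []
  · subst hz
    have := mk_mul_mk_left u g u' [] g' v'
    simpa [secW, smul_nil] using this
  · change InvSemi.mul _ _ = _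
    have : ¬ (u' ++ z <+: u') := fun h => hz (by have := h.length_le; simpa using this)
    simp [InvSemi.mul, this]

theorem mk_mul_mk_nil (u : List X) (g : G) (u' : List X) (g' : G) (v' : List X) :
    InvSemi.mk u g [] * InvSemi.mk u' g' v' =
      InvSemi.mk (u ++ g • u') (secW g u' * g') v' :=
  mk_mul_mk_left u g [] u' g' v'

theorem mk_nil_mul_mk (u : List X) (g : G) (v : List X) (g' : G) (v' : List X) :
    InvSemi.mk u g v * InvSemi.mk [] g' v' =
      InvSemi.mk u (g * (secW g'⁻¹ v)⁻¹) (v' ++ g'⁻¹ • v) :=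
  mk_mul_mk_right u g [] v g' v'

theorem mk_mul_mk_incomp {u : List X} {g : G} {v u' : List X} {g' : G} {v' : List X}
    (h1 : ¬ v <+: u') (h2 : ¬ u' <+: v) :
    InvSemi.mk u g v * InvSemi.mk u' g' v' = InvSemi.zero := by
  change InvSemi.mul _ _ = _
  simp [InvSemi.mul, h1, h2]

/-- The partial map of `u g v*` on a set `Ω` of words (finite or infinite), as a relation:
`u g v*` maps `v c` to `u g(c)`. Here `app` is concatenation, `ga` the action of the group. -/
def ActRel {Ω : Type*} (app : List X → Ω → Ω) (ga : G → Ω → Ω) (s : InvSemi G X) (a b : Ω) :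
    Prop :=
  ∃ u g v c, s = InvSemi.mk u g v ∧ a = app v c ∧ b = app u (ga g c)

theorem actRel_mul {Ω : Type*} {app : List X → Ω → Ω} {ga : G → Ω → Ω}
    (happ : ∀ u v a, app (u ++ v) a = app u (app v a))
    (hga : ∀ g v c, ga g (app v c) = app (g • v) (ga (secW g v) c))
    (hmul : ∀ g h c, ga (g * h) c = ga g (ga h c)) (hone : ∀ c, ga 1 c = c)
    (hinj : ∀ u a b, app u a = app u b → a = b)
    (hcomp : ∀ u v a b, app u a = app v b → u <+: v ∨ v <+: u)
    (s t : InvSemi G X) (a b : Ω) :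
    ActRel app ga (s * t) a b ↔ ∃ c, ActRel app ga t a c ∧ ActRel app ga s c b := by
  have hinv : ∀ g c, ga g (ga g⁻¹ c) = c := fun g c => by rw [← hmul, mul_inv_cancel, hone]
  have hinv' : ∀ g c, ga g⁻¹ (ga g c) = c := fun g c => by rw [← hmul, inv_mul_cancel, hone]
  constructor
  · rintro ⟨u₀, g₀, v₀, c, h, rfl, rfl⟩
    rcases s with _ | ⟨u, g, v⟩
    · rw [zero_mul_aux] at h; cases h
    rcases t with _ | ⟨u', g', v'⟩
    · rw [mul_zero_aux] at h; cases h
    by_cases h1 : v <+: u'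
    · obtain ⟨z, rfl⟩ := h1
      rw [mk_mul_mk_left] at h
      cases h
      refine ⟨app (v ++ z) (ga g' c), ⟨_, _, _, c, rfl, rfl, rfl⟩,
        ⟨_, _, _, app z (ga g' c), rfl, happ _ _ _, ?_⟩⟩
      rw [hga, happ, hmul]
    by_cases h2 : u' <+: v
    · obtain ⟨z, rfl⟩ := h2
      rw [mk_mul_mk_right] at h
      cases h
      refine ⟨app u' (ga g' (app (g'⁻¹ • z) c)), ⟨_, _, _, _, rfl, happ _ _ _, rfl⟩,
        ⟨_, _, _, ga (secW g'⁻¹ z)⁻¹ c, rfl, ?_, ?_⟩⟩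
      · rw [hga, happ, smul_inv_smul, secW_inv_mul]
      · rw [hmul]
    · rw [mk_mul_mk_incomp h1 h2] at h; cases h
  · rintro ⟨m, ⟨u', g', v', c, rfl, rfl, hm⟩, ⟨u, g, v, d, rfl, hm', rfl⟩⟩
    rw [hm] at hm'
    rcases hcomp _ _ _ _ hm' with ⟨z, rfl⟩ | ⟨z, rfl⟩
    · rw [happ] at hm'
      have h1 := hinj _ _ _ hm'
      rw [mk_mul_mk_right]
      refine ⟨_, _, _, ga (secW g'⁻¹ z) d, rfl, ?_, ?_⟩
      · rw [happ, ← hga, ← h1, hinv']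
      · rw [hmul, ← hmul _⁻¹, inv_mul_cancel, hone]
    · rw [happ] at hm'
      have h1 := hinj _ _ _ hm'
      rw [mk_mul_mk_left]
      refine ⟨_, _, _, c, rfl, rfl, ?_⟩
      rw [happ, hmul, ← h1, hga]

/-- On finite words, `S` acts by partial maps ... -/
theorem actRel_mul_list (s t : InvSemi G X) (a b : List X) :
    ActRel (· ++ ·) (· • ·) (s * t) a b ↔
      ∃ c, ActRel (· ++ ·) (· • ·) t a c ∧ ActRel (· ++ ·) (· • ·) s c b := by
  apply actRel_mul
  · intro u v a; simp
  · intro g v c; exact smul_append g v c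
  · intro g h c; exact mul_smul g h c
  · intro c; exact one_smul G c
  · intro u a b h; exact List.append_cancel_left h
  · intro u v a b h
    exact List.prefix_or_prefix_of_prefix ⟨a, h⟩ ⟨b, rfl⟩

/-- ... and this action is faithful, so that `S` is a semigroup of partial maps. -/
theorem actRel_list_faithful {s t : InvSemi G X}
    (h : ∀ a b : List X, ActRel (· ++ ·) (· • ·) s a b ↔ ActRel (· ++ ·) (· • ·) t a b) :
    s = t := by
  have key : ∀ (u : List X) (g : G) (v w : List X),
      ActRel (· ++ ·) (· • ·) (InvSemi.mk u g v) (v ++ w) (u ++ g • w) :=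
    fun u g v w => ⟨u, g, v, w, rfl, rfl, rfl⟩
  rcases s with _ | ⟨u, g, v⟩ <;> rcases t with _ | ⟨u', g', v'⟩
  · rfl
  · obtain ⟨_, _, _, _, h', _⟩ := (h _ _).2 (key u' g' v' []); cases h'
  · obtain ⟨_, _, _, _, h', _⟩ := (h _ _).1 (key u g v []); cases h'
  · obtain ⟨_, _, _, c, h1, h2, h3⟩ := (h _ _).1 (key u g v [])
    obtain ⟨_, _, _, d, h1', h2', h3'⟩ := (h _ _).2 (key u' g' v' [])
    cases h1; cases h1'
    simp only [List.append_nil, smul_nil] at h2 h3 h2' h3'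
    have hc : c = [] := by
      have e1 := congrArg List.length h2
      have e2 := congrArg List.length h2'
      simp only [List.length_append] at e1 e2
      exact List.length_eq_zero_iff.1 (by omega)
    subst hc
    simp only [List.append_nil, smul_nil] at h2 h3
    subst h2; subst h3
    congr 1
    apply faithful (X := X)
    intro w
    obtain ⟨_, _, _, e, h1, h2, h3⟩ := (h _ _).1 (key u g v w)
    cases h1
    have := List.append_cancel_left h2
    subst this
    exact List.append_cancel_left h3

instance : MonoidWithZero (InvSemi G X) where
  mul_assoc a b c := by
    apply actRel_list_faithful
    intro x y
    simp only [actRel_mul_list]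
    constructor
    · rintro ⟨p, h1, q, h2, h3⟩; exact ⟨q, ⟨p, h1, h2⟩, h3⟩
    · rintro ⟨q, ⟨p, h1, h2⟩, h3⟩; exact ⟨p, h1, q, h2, h3⟩
  one := InvSemi.mk [] 1 []
  one_mul s := by
    rcases s with _ | ⟨u, g, v⟩
    · rfl
    · have := mk_mul_mk_left [] (1 : G) [] u g v
      simp only [List.nil_append, one_smul, secW_one, one_mul] at this
      exact this
  mul_one s := by
    rcases s with _ | ⟨u, g, v⟩
    · rfl
    · have := mk_mul_mk_right u g [] v (1 : G) []
      simp only [List.nil_append, inv_one, one_smul, secW_one, mul_one] at this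
      exact this
  zero := InvSemi.zero
  zero_mul := zero_mul_aux
  mul_zero := mul_zero_aux

theorem InvSemi.one_def : (1 : InvSemi G X) = InvSemi.mk [] 1 [] := rfl

theorem InvSemi.zero_def : (0 : InvSemi G X) = InvSemi.zero := rfl

open scoped Classical in
/-- The action of `S` on infinite words by partial maps: `u g v*` maps `v w` to `u g(w)`, and is
undefined (`none`) elsewhere. -/
def omegaPartial : InvSemi G X → Stream' X → Option (Stream' X)
  | .zero, _ => none
  | .mk u g v, w =>
    if w.take v.length = v then some (u ++ₛ omegaAct g (w.drop v.length)) else none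

theorem take_append_aux (v : List X) (c : Stream' X) : (v ++ₛ c).take v.length = v := by
  induction v with
  | nil => simp
  | cons x v ih => rw [Stream'.cons_append_stream, List.length_cons, Stream'.take_succ,
      Stream'.head_cons, Stream'.tail_cons, ih]

theorem omegaPartial_eq_some (s : InvSemi G X) (a b : Stream' X) :
    omegaPartial s a = some b ↔ ActRel (· ++ₛ ·) omegaAct s a b := by
  rcases s with _ | ⟨u, g, v⟩
  · constructor
    · intro h; cases h
    · rintro ⟨_, _, _, _, h, _⟩; cases h
  · constructor
    · intro h
      simp only [omegaPartial] at h
      split_ifs at h with h1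
      cases h
      refine ⟨u, g, v, a.drop v.length, rfl, ?_, rfl⟩
      conv_lhs => rw [← Stream'.append_take_drop v.length a, h1]
    · rintro ⟨_, _, _, c, h, rfl, rfl⟩
      cases h
      simp [omegaPartial, take_append_aux, Stream'.drop_append_stream]

theorem omegaPartial_mul (s t : InvSemi G X) (w : Stream' X) :
    omegaPartial (s * t) w = (omegaPartial t w).bind (omegaPartial s) := by
  apply Option.ext
  intro b
  rw [Option.bind_eq_some_iff]
  simp only [omegaPartial_eq_some]
  apply actRel_mul
  · intro u v a; exact Stream'.append_append_stream u v a
  · intro g v c; exact omegaAct_append g v c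
  · intro g h c; exact omegaAct_mul g h c
  · intro c; exact omegaAct_one c
  · intro u a b h
    have := congrArg (Stream'.drop u.length) h
    simpa [Stream'.drop_append_stream] using this
  · intro u v a b h
    have h1 : u <+: (u ++ₛ a).take (u.length + v.length) := by
      have h2 := Stream'.append_take_drop u.length ((u ++ₛ a))
      rw [Stream'.take_add, take_append_aux]
      exact ⟨_, rfl⟩
    have h2 : v <+: (v ++ₛ b).take (u.length + v.length) := by
      rw [add_comm, Stream'.take_add, take_append_aux]
      exact ⟨_, rfl⟩
    have h' : (u ++ₛ a) = (v ++ₛ b) := h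
    rw [h'] at h1
    exact List.prefix_or_prefix_of_prefix h1 h2

theorem omegaPartial_one (w : Stream' X) : omegaPartial (1 : InvSemi G X) w = some w := by
  rw [omegaPartial_eq_some]
  exact ⟨[], 1, [], w, rfl, rfl, by simp [omegaAct_one]⟩

end InvSemigroup

/-! ### Contracted semigroup algebras, tight and singular ideals -/

section Contracted

variable (K S : Type*) [Field K] [MonoidWithZero S]

theorem eq_single_zero_of_coeff {K S : Type*} [Field K] [MonoidWithZero S]
    {a : MonoidAlgebra K S} (ha : ∀ s : S, s ≠ 0 → a.coeff s = 0) :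
    a = MonoidAlgebra.single 0 (a.coeff 0) := by
  ext s
  by_cases hs : s = 0
  · subst hs; simp
  · simp [ha s hs, Ne.symm hs]

/-- The ideal `K · 0_S` of the semigroup algebra `K S`: it consists of the elements all of whose
coefficients at non-zero elements of `S` vanish. -/
def zeroIdeal : Ideal (MonoidAlgebra K S) where
  carrier := {a | ∀ s : S, s ≠ 0 → a.coeff s = 0}
  add_mem' := by
    intro a b ha hb s hs
    simp [ha s hs, hb s hs]
  zero_mem' := by
    intro s hs
    simp
  smul_mem' := by
    intro c a ha
    rw [eq_single_zero_of_coeff ha]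
    intro s hs
    induction c using MonoidAlgebra.induction_on with
    | of m => simp [MonoidAlgebra.single_mul_single, Ne.symm hs]
    | add x y hx hy =>
      simp only [smul_eq_mul] at hx hy ⊢
      simp [add_mul, hx, hy]
    | smul r x hx =>
      simp only [smul_eq_mul] at hx ⊢
      simp [hx]

instance : (zeroIdeal K S).IsTwoSided where
  mul_mem_of_left := by
    intro a c ha
    rw [eq_single_zero_of_coeff ha]
    intro s hs
    induction c using MonoidAlgebra.induction_on with
    | of m => simp [MonoidAlgebra.single_mul_single, Ne.symm hs]
    | add x y hx hy => simp [mul_add, hx, hy]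
    | smul r x hx => simp [hx]

/-- The contracted semigroup algebra `K₀S`: the semigroup algebra `K S` with the zero of `S`
identified with the zero of `K S`. -/
abbrev ContractedAlgebra : Type _ := MonoidAlgebra K S ⧸ zeroIdeal K S

variable {S}

/-- The element of `K₀S` given by an element of `S`. -/
def ofS (s : S) : ContractedAlgebra K S :=
  Ideal.Quotient.mkₐ K (zeroIdeal K S) (MonoidAlgebra.of K S s)

variable {K}

/-- The homomorphism from `K₀S` that extends a homomorphism of monoids with zero from `S`. -/
def contractedLift {A : Type*} [Semiring A] [Algebra K A] (f : S →*₀ A) :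
    ContractedAlgebra K S →ₐ[K] A :=
  Ideal.Quotient.liftₐ (zeroIdeal K S) (MonoidAlgebra.lift K A S (f : S →* A)) (by
    intro a ha
    rw [eq_single_zero_of_coeff ha, MonoidAlgebra.lift_single]
    simp)

theorem contractedLift_ofS {A : Type*} [Semiring A] [Algebra K A] (f : S →*₀ A) (s : S) :
    contractedLift (K := K) f (ofS K s) = f s := by
  change MonoidAlgebra.lift K A S (f : S →* A) (MonoidAlgebra.of K S s) = f s
  rw [MonoidAlgebra.lift_of]
  rfl

/-- The list `F` of idempotents covers the idempotent `e`: every `f ∈ F` is below `e`, and every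
non-zero idempotent below `e` has a non-zero meet with some `f ∈ F`. Here `f ≤ e` means
`f * e = f`. -/
structure IsCover (F : List S) (e : S) : Prop where
  idempotent : ∀ f ∈ F, IsIdempotentElem f
  le : ∀ f ∈ F, f * e = f
  meets : ∀ f', IsIdempotentElem f' → f' ≠ 0 → f' * e = f' → ∃ f ∈ F, f' * f ≠ 0

variable (K S)

/-- The tight ideal of `K₀S`, generated by the products `∏_{f ∈ F} (e - f)` with `e` an idempotent
and `F` a finite cover of `e`. The products are formed in the corner with identity `e`, that is,
the empty product is `e` (and occurs only for `e = 0`, as the empty set covers no other `e`). -/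
def tightIdeal : TwoSidedIdeal (ContractedAlgebra K S) :=
  TwoSidedIdeal.span {a | ∃ (e : S) (F : List S), IsIdempotentElem e ∧ IsCover F e ∧
    a = ofS K e * (F.map fun f => ofS K e - ofS K f).prod}

/-- The set of singular elements of `K₀S`: those `a` such that every non-zero idempotent `e`
has a non-zero idempotent `f ≤ e` below it with `a f = 0`. -/
def singularIdeal : Set (ContractedAlgebra K S) :=
  {a | ∀ e : S, IsIdempotentElem e → e ≠ 0 →
    ∃ f : S, IsIdempotentElem f ∧ f ≠ 0 ∧ f * e = f ∧ a * ofS K f = 0}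

end Contracted

/-! ### The representation of `K₀S` on the space with basis the infinite words -/

section Rep

variable (K G X : Type*) [Field K] [Group G] [SelfSimilarGroup G X]

/-- The vector space `K X^ω` with basis the infinite words. -/
abbrev OmegaSpace : Type _ := Stream' X →₀ K

variable {G X}

/-- The operator on `K X^ω` given by `s ∈ S`: it maps the basis vector `w` to `s(w)` if this is
defined, and to `0` otherwise. -/
def omegaOp (s : InvSemi G X) : Module.End K (OmegaSpace K X) :=
  Finsupp.linearCombination K fun w =>
    (omegaPartial s w).elim 0 fun w' => Finsupp.single w' (1 : K)

theorem omegaOp_single (s : InvSemi G X) (w : Stream' X) :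
    omegaOp K s (Finsupp.single w 1) =
      (omegaPartial s w).elim 0 fun w' => Finsupp.single w' (1 : K) := by
  simp [omegaOp]

variable (G X)

/-- The action of `S` on `K X^ω`. -/
def omegaHom : InvSemi G X →*₀ Module.End K (OmegaSpace K X) where
  toFun := omegaOp K
  map_zero' := by
    apply Finsupp.lhom_ext'
    intro w
    ext : 1
    simp only [LinearMap.comp_apply, Finsupp.lsingle_apply, omegaOp_single]
    rfl
  map_one' := by
    apply Finsupp.lhom_ext'
    intro w
    ext : 1
    simp [LinearMap.comp_apply, Finsupp.lsingle_apply, omegaOp_single, omegaPartial_one]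
  map_mul' s t := by
    apply Finsupp.lhom_ext'
    intro w
    ext : 1
    simp only [LinearMap.comp_apply, Finsupp.lsingle_apply, omegaOp_single, omegaPartial_mul,
      Module.End.mul_apply]
    cases omegaPartial t w with
    | none => simp
    | some b => simp [omegaOp_single]

/-- The natural representation of `K₀S` on `K X^ω`. -/
def omegaRep : ContractedAlgebra K (InvSemi G X) →ₐ[K] Module.End K (OmegaSpace K X) :=
  contractedLift (omegaHom K G X)

variable {G X}

theorem omegaRep_ofS (s : InvSemi G X) : omegaRep K G X (ofS K s) = omegaOp K s :=
  contractedLift_ofS _ s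

end Rep

/-! ### The Nekrashevych algebra -/

/-- The generators `x`, `x*`, `g`, `g*` of the Nekrashevych algebra. -/
inductive NekGen (G X : Type*) : Type _
  | letter (x : X) : NekGen G X
  | letterStar (x : X) : NekGen G X
  | elt (g : G) : NekGen G X
  | eltStar (g : G) : NekGen G X

section Nek

variable (K : Type*) {G X : Type*} [Field K]

/-- The generator `x` of the free algebra. -/
abbrev genL (x : X) : FreeAlgebra K (NekGen G X) := FreeAlgebra.ι K (NekGen.letter x)

/-- The generator `x*` of the free algebra. -/
abbrev genLs (x : X) : FreeAlgebra K (NekGen G X) := FreeAlgebra.ι K (NekGen.letterStar x)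

/-- The generator `g` of the free algebra. -/
abbrev genE (g : G) : FreeAlgebra K (NekGen G X) := FreeAlgebra.ι K (NekGen.elt g)

/-- The generator `g*` of the free algebra. -/
abbrev genEs (g : G) : FreeAlgebra K (NekGen G X) := FreeAlgebra.ι K (NekGen.eltStar g)

variable (G X)
variable [Group G] [SelfSimilarGroup G X] [Fintype X]

/-- The defining relations of the Nekrashevych algebra as a `*`-algebra generated by `X` and `G`:
the identity of `G` is `1`, `g* = g⁻¹`, `g · h = gh`, `g x = g(x) g|ₓ`, `y* x = δ_{x,y}` and
`∑ x x* = 1`; together with the images of these relations under the involution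
(the relations `ck1`, `ck1_ne` and `ck2` are closed under it). -/
inductive NekRel : FreeAlgebra K (NekGen G X) → FreeAlgebra K (NekGen G X) → Prop
  | one : NekRel (genE K 1) 1
  | one_star : NekRel (genEs K 1) 1
  | inv (g : G) : NekRel (genEs K g) (genE K g⁻¹)
  | inv_star (g : G) : NekRel (genE K g) (genEs K g⁻¹)
  | mul (g h : G) : NekRel (genE K g * genE K h) (genE K (g * h))
  | mul_star (g h : G) : NekRel (genEs K h * genEs K g) (genEs K (g * h))
  | ss (g : G) (x : X) : NekRel (genE K g * genL K x) (genL K (letter g x) * genE K (sec g x))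
  | ss_star (g : G) (x : X) :
      NekRel (genLs K x * genEs K g) (genEs K (sec g x) * genLs K (letter g x))
  | ck1 (x : X) : NekRel (genLs K x * genL K x) 1
  | ck1_ne (x y : X) : x ≠ y → NekRel (genLs K y * genL K x) 0
  | ck2 : NekRel (∑ x : X, genL K x * genLs K x) 1

/-- The Nekrashevych algebra of the self-similar group `(G, X)` over `K`. -/
abbrev NekAlgebra : Type _ := RingQuot (NekRel K G X)

variable {G X}

/-- The element of the inverse semigroup that corresponds to a generator. -/
def NekGen.toInv : NekGen G X → InvSemi G X
  | .letter x => .mk [x] 1 []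
  | .letterStar x => .mk [] 1 [x]
  | .elt g => .mk [] g []
  | .eltStar g => .mk [] g⁻¹ []

theorem omegaOp_sum_letters :
    ∑ x : X, omegaOp K (InvSemi.mk [x] 1 [x] : InvSemi G X) = 1 := by
  apply Finsupp.lhom_ext'
  intro w
  ext : 1
  simp only [LinearMap.comp_apply, Finsupp.lsingle_apply, LinearMap.sum_apply, omegaOp_single,
    Module.End.one_apply]
  rw [Finset.sum_eq_single w.head]
  · have : omegaPartial (InvSemi.mk [w.head] (1 : G) [w.head]) w = some w := by
      rw [omegaPartial_eq_some]
      refine ⟨_, _, _, w.tail, rfl, ?_, ?_⟩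
      · exact (Stream'.append_stream_head_tail w).symm
      · simp only [omegaAct_one]
        exact (Stream'.append_stream_head_tail w).symm
    rw [this]
    rfl
  · intro x _ hx
    have : omegaPartial (InvSemi.mk [x] (1 : G) [x]) w = none := by
      rw [Option.eq_none_iff_forall_ne_some]
      intro b hb
      rw [omegaPartial_eq_some] at hb
      obtain ⟨_, _, _, c, h, h', _⟩ := hb
      cases h
      apply hx
      rw [h']
      rfl
    rw [this]
    rfl
  · intro h
    exact absurd (Finset.mem_univ _) h

/-- The representation of the free algebra on `K X^ω` that induces `nekRep`. -/
def freeRep : FreeAlgebra K (NekGen G X) →ₐ[K] Module.End K (OmegaSpace K X) :=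
  FreeAlgebra.lift K fun y => omegaHom K G X y.toInv

theorem freeRep_rel ⦃a b : FreeAlgebra K (NekGen G X)⦄ (h : NekRel K G X a b) :
    freeRep K a = freeRep K b := by
  induction h with
  | one =>
    simp only [freeRep, FreeAlgebra.lift_ι_apply, NekGen.toInv, map_one]
    exact map_one (omegaHom K G X)
  | one_star =>
    simp only [freeRep, FreeAlgebra.lift_ι_apply, NekGen.toInv, map_one, inv_one]
    exact map_one (omegaHom K G X)
  | inv g => simp [freeRep, NekGen.toInv]
  | inv_star g => simp [freeRep, NekGen.toInv]
  | mul g h =>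
    simp only [freeRep, map_mul, FreeAlgebra.lift_ι_apply, NekGen.toInv]
    simp [← map_mul, mk_mul_mk_nil, mk_nil_mul_mk, smul_nil, secW, smul_singleton]
  | mul_star g h =>
    simp only [freeRep, map_mul, FreeAlgebra.lift_ι_apply, NekGen.toInv]
    simp [← map_mul, mk_mul_mk_nil, mk_nil_mul_mk, smul_nil, secW, smul_singleton]
  | ss g x =>
    simp only [freeRep, map_mul, FreeAlgebra.lift_ι_apply, NekGen.toInv]
    simp [← map_mul, mk_mul_mk_nil, mk_nil_mul_mk, smul_nil, secW, smul_singleton]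
  | ss_star g x =>
    simp only [freeRep, map_mul, FreeAlgebra.lift_ι_apply, NekGen.toInv]
    simp [← map_mul, mk_mul_mk_nil, mk_nil_mul_mk, smul_nil, secW, smul_singleton]
  | ck1 x =>
    have := mk_mul_mk_left [] (1 : G) [x] [] 1 []
    simp only [List.append_nil, smul_nil, secW, mul_one] at this
    simp only [freeRep, map_mul, FreeAlgebra.lift_ι_apply, NekGen.toInv]
    rw [← map_mul, this, map_one]
    exact map_one (omegaHom K G X)
  | ck1_ne x y hxy =>
    have : InvSemi.mk [] (1 : G) [y] * InvSemi.mk [x] 1 [] = 0 :=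
      mk_mul_mk_incomp (by simpa using Ne.symm hxy) (by simpa using hxy)
    simp only [freeRep, map_mul, FreeAlgebra.lift_ι_apply, NekGen.toInv]
    rw [← map_mul, this, map_zero, map_zero]
  | ck2 =>
    have h : ∀ x : X, InvSemi.mk [x] (1 : G) [] * InvSemi.mk [] 1 [x] = InvSemi.mk [x] 1 [x] := by
      intro x
      simp [mk_mul_mk_nil, smul_nil, secW]
    simp only [freeRep, map_sum, map_mul, FreeAlgebra.lift_ι_apply, NekGen.toInv, map_one]
    simp only [← map_mul, h]
    exact omegaOp_sum_letters K

variable (G X)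

/-- The representation of the Nekrashevych algebra on `K X^ω`: the generators `x`, `x*`, `g`, `g*`
act by the corresponding partial maps of `X^ω`. -/
def nekRep : NekAlgebra K G X →ₐ[K] Module.End K (OmegaSpace K X) :=
  RingQuot.liftAlgHom K ⟨freeRep K, freeRep_rel K⟩

variable {G X}

/-- The element `x` of the Nekrashevych algebra. -/
def nekL (x : X) : NekAlgebra K G X := RingQuot.mkAlgHom K (NekRel K G X) (genL K x)

/-- The element `x*` of the Nekrashevych algebra. -/
def nekLs (x : X) : NekAlgebra K G X := RingQuot.mkAlgHom K (NekRel K G X) (genLs K x)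

/-- The element `g` of the Nekrashevych algebra. -/
def nekE (g : G) : NekAlgebra K G X := RingQuot.mkAlgHom K (NekRel K G X) (genE K g)

variable (G) in
/-- The element `w = x₁ ⋯ xₙ` of the Nekrashevych algebra. -/
def nekW (w : List X) : NekAlgebra K G X := (w.map (nekL K)).prod

variable (G) in
/-- The element `w* = xₙ* ⋯ x₁*` of the Nekrashevych algebra. -/
def nekWs (w : List X) : NekAlgebra K G X := (w.reverse.map (nekLs K)).prod

theorem nekE_one : nekE K (1 : G) = (1 : NekAlgebra K G X) := by
  simpa [nekE] using RingQuot.mkAlgHom_rel K (NekRel.one (K := K) (G := G) (X := X))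

theorem nekE_mul (g h : G) : (nekE K g * nekE K h : NekAlgebra K G X) = nekE K (g * h) := by
  simpa [nekE] using RingQuot.mkAlgHom_rel K (NekRel.mul (K := K) (X := X) g h)

theorem nekE_nekL (g : G) (x : X) :
    (nekE K g * nekL K x : NekAlgebra K G X) = nekL K (letter g x) * nekE K (sec g x) := by
  simpa [nekE, nekL] using RingQuot.mkAlgHom_rel K (NekRel.ss (K := K) g x)

theorem nekLs_nekE (g : G) (x : X) :
    (nekLs K x * nekE K g⁻¹ : NekAlgebra K G X) =
      nekE K (sec g x)⁻¹ * nekLs K (letter g x) := by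
  have h := RingQuot.mkAlgHom_rel K (NekRel.ss_star (K := K) g x)
  have h1 := RingQuot.mkAlgHom_rel K (NekRel.inv (K := K) (X := X) g)
  have h2 := RingQuot.mkAlgHom_rel K (NekRel.inv (K := K) (X := X) (sec g x))
  rw [map_mul, map_mul, h1, h2] at h
  exact h

theorem nekLs_nekL (x : X) : (nekLs K x * nekL K x : NekAlgebra K G X) = 1 := by
  simpa [nekLs, nekL] using RingQuot.mkAlgHom_rel K (NekRel.ck1 (K := K) (G := G) x)

theorem nekLs_nekL_ne {x y : X} (h : x ≠ y) :
    (nekLs K y * nekL K x : NekAlgebra K G X) = 0 := by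
  simpa [nekLs, nekL] using RingQuot.mkAlgHom_rel K (NekRel.ck1_ne (K := K) (G := G) x y h)

theorem nekW_append (u v : List X) : nekW K G (u ++ v) = nekW K G u * nekW K G v := by
  simp [nekW]

theorem nekWs_append (u v : List X) : nekWs K G (u ++ v) = nekWs K G v * nekWs K G u := by
  simp [nekWs]

theorem nekW_cons (x : X) (v : List X) : nekW K G (x :: v) = nekL K x * nekW K G v := by
  simp [nekW]

theorem nekWs_cons (x : X) (v : List X) : nekWs K G (x :: v) = nekWs K G v * nekLs K x := by
  simp [nekWs]

theorem nekW_nil : nekW K G ([] : List X) = 1 := rfl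

theorem nekWs_nil : nekWs K G ([] : List X) = 1 := rfl

theorem nekE_nekW (g : G) (w : List X) :
    nekE K g * nekW K G w = nekW K G (g • w) * nekE K (secW g w) := by
  induction w generalizing g with
  | nil => simp [nekW_nil, smul_nil, secW]
  | cons x w ih => rw [nekW_cons, ← mul_assoc, nekE_nekL, mul_assoc, ih, smul_cons, nekW_cons,
      mul_assoc, secW]

theorem nekWs_nekE (g : G) (w : List X) :
    nekWs K G w * nekE K g⁻¹ = nekE K (secW g w)⁻¹ * nekWs K G (g • w) := by
  induction w generalizing g with
  | nil => simp [nekWs_nil, smul_nil, secW]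
  | cons x w ih => rw [nekWs_cons, mul_assoc, nekLs_nekE, ← mul_assoc, ih, smul_cons, nekWs_cons,
      mul_assoc, secW]

theorem nekWs_nekW (w : List X) : nekWs K G w * nekW K G w = 1 := by
  induction w with
  | nil => simp [nekW_nil, nekWs_nil]
  | cons x w ih => rw [nekWs_cons, nekW_cons, mul_assoc, ← mul_assoc (nekLs K x), nekLs_nekL,
      one_mul, ih]

theorem nekWs_nekW_incomp {u v : List X} (h1 : ¬ u <+: v) (h2 : ¬ v <+: u) :
    nekWs K G u * nekW K G v = 0 := by
  induction u generalizing v with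
  | nil => exact absurd List.nil_prefix h1
  | cons x u ih =>
    cases v with
    | nil => exact absurd List.nil_prefix h2
    | cons y v =>
      rw [nekWs_cons, nekW_cons, mul_assoc, ← mul_assoc (nekLs K x)]
      by_cases h : y = x
      · subst h
        rw [nekLs_nekL, one_mul]
        apply ih
        · simpa using h1
        · simpa using h2
      · rw [nekLs_nekL_ne K h, zero_mul, mul_zero]

/-- The element `u g v*` of the Nekrashevych algebra. -/
def nekOf : InvSemi G X → NekAlgebra K G X
  | .zero => 0
  | .mk u g v => nekW K G u * nekE K g * nekWs K G v

theorem nekOf_mul (s t : InvSemi G X) : nekOf K (s * t) = nekOf K s * nekOf K t := by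
  rcases s with _ | ⟨u, g, v⟩
  · rw [zero_mul_aux]; simp [nekOf]
  rcases t with _ | ⟨u', g', v'⟩
  · rw [mul_zero_aux]; simp [nekOf]
  by_cases h1 : v <+: u'
  · obtain ⟨z, rfl⟩ := h1
    rw [mk_mul_mk_left]
    simp only [nekOf, nekW_append]
    calc _ = nekW K G u * (nekW K G (g • z) * nekE K (secW g z)) * nekE K g' * nekWs K G v' := by
          rw [← nekE_mul]; simp only [mul_assoc]
      _ = nekW K G u * nekE K g * 1 * nekW K G z * nekE K g' * nekWs K G v' := by
          rw [← nekE_nekW]; simp only [mul_assoc, one_mul]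
      _ = _ := by rw [← nekWs_nekW K v]; simp only [mul_assoc]
  by_cases h2 : u' <+: v
  · obtain ⟨z, rfl⟩ := h2
    rw [mk_mul_mk_right]
    simp only [nekOf, nekWs_append]
    have hz := nekWs_nekE K g'⁻¹ z
    rw [inv_inv] at hz
    calc _ = nekW K G u * nekE K g * (nekE K (secW g'⁻¹ z)⁻¹ * nekWs K G (g'⁻¹ • z)) *
            nekWs K G v' := by
          rw [← nekE_mul]; simp only [mul_assoc]
      _ = nekW K G u * nekE K g * nekWs K G z * 1 * nekE K g' * nekWs K G v' := by
          rw [← hz]; simp only [mul_assoc, one_mul]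
      _ = _ := by rw [← nekWs_nekW K u']; simp only [mul_assoc]
  · rw [mk_mul_mk_incomp h1 h2]
    simp only [nekOf]
    calc (0 : NekAlgebra K G X)
        = nekW K G u * nekE K g * (nekWs K G v * nekW K G u') * nekE K g' * nekWs K G v' := by
          rw [nekWs_nekW_incomp K h1 h2]; simp
      _ = _ := by simp only [mul_assoc]

variable (G X)

/-- The homomorphism from `S` to the Nekrashevych algebra. -/
def nekHom : InvSemi G X →*₀ NekAlgebra K G X where
  toFun := nekOf K
  map_zero' := rfl
  map_one' := by
    rw [InvSemi.one_def]
    simp [nekOf, nekW_nil, nekWs_nil, nekE_one]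
  map_mul' := nekOf_mul K

/-- The canonical homomorphism from `K₀S` to the Nekrashevych algebra, which maps the element
`u g v*` of `S` to the element `u g v*` of the Nekrashevych algebra. -/
def nekQuot : ContractedAlgebra K (InvSemi G X) →ₐ[K] NekAlgebra K G X :=
  contractedLift (nekHom K G X)

variable {G X}

theorem nekQuot_ofS (s : InvSemi G X) : nekQuot K G X (ofS K s) = nekOf K s :=
  contractedLift_ofS _ s

end Nek

end Nekrashevych
end

/-! Nonzero idempotents of `S` are the elements `ww*`, that is, the cylinders of words, and
multiplying by `ww*` on the right restricts a partial map to the cylinder of `w`. Since `|X| ≥ 2`,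
elements of `S` are determined by their action on infinite words (`eq_of_omegaPartial_eq`), and this
action is continuous.

Kernel = Sing. Write `a = ∑ c_s s` over a finite set `T`. Two elements of `S` that differ at a point
of a cylinder differ everywhere near it, so each cylinder contains one, say that of `w`, on which
any two elements of `T` agree or differ everywhere (`exists_finset_separated`). For `ξ` in it, `a
ww*` is then a linear function of `a ξ`, so an element of the kernel is singular. Conversely, the
coefficient of `η` in `a ξ` can be read off from `a ζ` for every `ζ` close to `ξ`
(`exists_take_iff`), and a singular `a` kills some such `ζ`.

The quotient. In `𝒩` the idempotent of a cylinder is the sum of those of its subcylinders at any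
fixed depth, and at sufficient depth each subcylinder lies in a member of a given cover; so the
tight products vanish (`nekQuot_tight`). Conversely `1 - ∑ xx* = ∏ (1 - xx*)` is tight, and a
homomorphism on `K₀S` killing it factors through `𝒩` by generators and relations
(`eq_zero_of_nekQuot_eq_zero`). Hence the kernel is exactly Tight, and it lies in Sing because the
representation of `K₀S` factors through `𝒩`.

Simplicity. If `a` is not singular, cutting it by idempotents of small cylinders around some `ξ` and
`η` leaves a nonzero multiple of a nonzero element of `S` (`exists_mul_mul_eq_smul_ofS`), and such
an element generates the unit ideal (`exists_mul_mul_eq_one`). So every ideal of `𝒩` not inside the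
kernel of its representation is everything. -/

namespace Nekrashevych

/-! ### Idempotents and cylinders -/

section Cylinders

variable {G X : Type*} [Group G] [SelfSimilarGroup G X]

open SelfSimilarGroup

variable (G) in
/-- The idempotent `w w*`. -/
def idem (w : List X) : InvSemi G X := .mk w 1 w

theorem idem_ne_zero (w : List X) : idem G w ≠ 0 := nofun

theorem idem_mul_idem_append (w z : List X) : idem G w * idem G (w ++ z) = idem G (w ++ z) := by
  simp [idem, mk_mul_mk_left, secW_one]

theorem idem_append_mul_idem (w z : List X) : idem G (w ++ z) * idem G w = idem G (w ++ z) := by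
  simp [idem, mk_mul_mk_right, secW_one]

theorem isIdempotentElem_idem (w : List X) : IsIdempotentElem (idem G w) := by
  simpa [IsIdempotentElem] using idem_mul_idem_append (G := G) w []

theorem prefix_or_prefix_of_mul_ne_zero {u : List X} {g : G} {v u' : List X} {g' : G}
    {v' : List X} (h : InvSemi.mk u g v * InvSemi.mk u' g' v' ≠ 0) : v <+: u' ∨ u' <+: v := by
  by_contra! hc
  exact h (mk_mul_mk_incomp hc.1 hc.2)

/-- A nonzero square of `u g v*` has a longer outer word unless `u = v`, because the group preserves
lengths; then `g * g = g` leaves only `g = 1`. -/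
theorem exists_eq_idem {e : InvSemi G X} (he : IsIdempotentElem e) (h0 : e ≠ 0) :
    ∃ w, e = idem G w := by
  rcases e with _ | ⟨u, g, v⟩
  · exact absurd rfl h0
  have he' : InvSemi.mk u g v * InvSemi.mk u g v = InvSemi.mk u g v := he
  have key : u = v := by
    rcases prefix_or_prefix_of_mul_ne_zero (he'.symm ▸ h0) with ⟨z, rfl⟩ | ⟨z, rfl⟩
    · rw [mk_mul_mk_left] at he'
      injection he' with h1 h2 h3
      have := congrArg List.length h1
      simp only [List.length_append, length_smul] at this
      rw [List.length_eq_zero_iff.1 (by omega : z.length = 0), List.append_nil]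
    · rw [mk_mul_mk_right] at he'
      injection he' with h1 h2 h3
      have := congrArg List.length h3
      simp only [List.length_append, length_smul] at this
      rw [List.length_eq_zero_iff.1 (by omega : z.length = 0), List.append_nil]
  subst key
  have h := mk_mul_mk_left u g u [] g u
  rw [List.append_nil, he'] at h
  injection h with h1 h2 h3
  exact ⟨u, by rw [idem, show g = 1 by simpa [secW] using h2]⟩

theorem prefix_of_idem_mul_idem {u w : List X} (h : idem G w * idem G u = idem G w) :
    u <+: w := by
  rcases prefix_or_prefix_of_mul_ne_zero (h.symm ▸ idem_ne_zero w) with ⟨z, rfl⟩ | hz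
  · rw [idem_mul_idem_append] at h
    injection h with h1
    exact ⟨[], by rw [List.append_nil, h1]⟩
  · exact hz

theorem take_eq_of_prefix {u w : List X} (h : u <+: w) {ξ : Stream' X}
    (hξ : ξ.take w.length = w) : ξ.take u.length = u := by
  have h1 := List.prefix_iff_eq_take.1 h
  rw [← hξ, Stream'.take_take, min_eq_right h.length_le] at h1
  exact h1.symm

theorem take_eq_take_of_le {m n : ℕ} (h : m ≤ n) {ξ ζ : Stream' X}
    (hξ : ζ.take n = ξ.take n) : ζ.take m = ξ.take m := by
  rw [← min_eq_right h, ← Stream'.take_take, hξ, Stream'.take_take]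

theorem prefix_take {u : List X} {ξ : Stream' X} (hξ : ξ.take u.length = u) {n : ℕ}
    (h : u.length ≤ n) : u <+: ξ.take n := by
  obtain ⟨k, rfl⟩ := Nat.exists_eq_add_of_le h
  rw [Stream'.take_add, hξ]
  exact ⟨_, rfl⟩

theorem omegaPartial_idem {w : List X} {ξ : Stream' X} (hξ : ξ.take w.length = w) :
    omegaPartial (idem G w) ξ = some ξ := by
  rw [idem, omegaPartial, if_pos hξ, omegaAct_one]
  conv_rhs => rw [← Stream'.append_take_drop w.length ξ, hξ]

theorem omegaPartial_idem_of_ne {w : List X} {ξ : Stream' X} (hξ : ξ.take w.length ≠ w) :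
    omegaPartial (idem G w) ξ = none := by
  rw [idem, omegaPartial, if_neg hξ]

theorem omegaPartial_mul_idem (s : InvSemi G X) {w : List X} {ξ : Stream' X}
    (hξ : ξ.take w.length = w) : omegaPartial (s * idem G w) ξ = omegaPartial s ξ := by
  rw [omegaPartial_mul, omegaPartial_idem hξ]
  rfl

/-- Elements of `S` act continuously on infinite words. -/
theorem exists_take_omegaPartial (s : InvSemi G X) (n : ℕ) : ∃ N, ∀ ξ ζ : Stream' X,
    ζ.take N = ξ.take N →
      (omegaPartial s ζ).map (Stream'.take n) = (omegaPartial s ξ).map (Stream'.take n) := by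
  rcases s with _ | ⟨u, g, v⟩
  · exact ⟨0, fun _ _ _ => rfl⟩
  -- The first `v.length` letters decide whether the map is defined; the next `n` determine
  -- `u.length + n` letters of the image.
  refine ⟨v.length + n, fun ξ ζ h => ?_⟩
  rw [Stream'.take_add, Stream'.take_add] at h
  obtain ⟨h1, h2⟩ := List.append_inj h (by simp)
  simp only [omegaPartial]
  by_cases hv : ξ.take v.length = v
  · rw [if_pos hv, if_pos (h1.trans hv)]
    simp only [Option.map_some, Option.some.injEq]
    apply take_eq_take_of_le (Nat.le_add_left n u.length)
    rw [Stream'.take_add, Stream'.take_add, take_append_aux, take_append_aux,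
      Stream'.drop_append_stream, Stream'.drop_append_stream, ← smul_take, ← smul_take, h2]
  · rw [if_neg hv, if_neg (h1 ▸ hv)]

theorem exists_take_omegaPartial_ne {a b : Option (Stream' X)} (h : a ≠ b) :
    ∃ n, a.map (Stream'.take n) ≠ b.map (Stream'.take n) := by
  rcases a with _ | a <;> rcases b with _ | b
  · exact absurd rfl h
  · exact ⟨0, by simp⟩
  · exact ⟨0, by simp⟩
  · by_contra! hc
    exact h (congrArg some (Stream'.take_theorem _ _ fun n => by simpa using hc n))

/-! ### Faithfulness of the action on infinite words -/

/-- Two letters are needed: over a one-letter alphabet all cylinders coincide. -/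
theorem prefix_of_cylinder_subset [Nontrivial X] {u v : List X}
    (h : ∀ ξ : Stream' X, ξ.take v.length = v → ξ.take u.length = u) : u <+: v := by
  obtain ⟨x⟩ : Nonempty X := inferInstance
  induction u generalizing v with
  | nil => exact List.nil_prefix
  | cons a u ih =>
    cases v with
    | nil =>
      obtain ⟨y, hy⟩ := exists_ne a
      have := h (Stream'.const y) rfl
      rw [List.length_cons, Stream'.take_succ] at this
      injection this with h1
      exact absurd h1 hy
    | cons b v =>
      have h' : ∀ ξ : Stream' X, ξ.take v.length = v → b = a ∧ ξ.take u.length = u := by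
        intro ξ hξ
        have := h (Stream'.cons b ξ) (by rw [List.length_cons, Stream'.take_succ_cons, hξ])
        rw [List.length_cons, Stream'.take_succ_cons] at this
        injection this with h1 h2
        exact ⟨h1, h2⟩
      rw [(h' (v ++ₛ Stream'.const x) (take_append_aux _ _)).1]
      exact (List.prefix_cons_inj a).2 (ih fun ξ hξ => (h' ξ hξ).2)

theorem eq_of_cylinder_eq [Nontrivial X] {u v : List X}
    (h : ∀ ξ : Stream' X, ξ.take v.length = v ↔ ξ.take u.length = u) : u = v := by
  have h1 := prefix_of_cylinder_subset fun ξ => (h ξ).1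
  have h2 := prefix_of_cylinder_subset fun ξ => (h ξ).2
  exact h1.eq_of_length (le_antisymm h1.length_le h2.length_le)

theorem omegaPartial_append (u : List X) (g : G) (v : List X) (ξ : Stream' X) :
    omegaPartial (InvSemi.mk u g v) (v ++ₛ ξ) = some (u ++ₛ omegaAct g ξ) := by
  rw [omegaPartial, if_pos (take_append_aux _ _), Stream'.drop_append_stream]

/-- The first map takes every value in the cylinder of `u`, since `g` is invertible on infinite
words, while all values of the second lie in the cylinder of `u'`. -/
theorem prefix_range [Nontrivial X] {u : List X} {g : G} {v u' : List X} {g' : G}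
    (h : ∀ ξ : Stream' X, omegaPartial (InvSemi.mk u g v) ξ =
      omegaPartial (InvSemi.mk u' g' v) ξ) : u' <+: u := by
  apply prefix_of_cylinder_subset
  intro η hη
  have h1 := h (v ++ₛ omegaAct g⁻¹ (η.drop u.length))
  rw [omegaPartial_append, omegaPartial_append, ← omegaAct_mul, mul_inv_cancel, omegaAct_one] at h1
  nth_rw 1 [← hη] at h1
  rw [Stream'.append_take_drop] at h1
  rw [Option.some.inj h1, take_append_aux]

/-- The action of `S` on infinite words is faithful. -/
theorem eq_of_omegaPartial_eq [Nontrivial X] {s t : InvSemi G X}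
    (h : ∀ ξ, omegaPartial s ξ = omegaPartial t ξ) : s = t := by
  obtain ⟨x⟩ : Nonempty X := inferInstance
  rcases s with _ | ⟨u, g, v⟩ <;> rcases t with _ | ⟨u', g', v'⟩
  · rfl
  · have := h (v' ++ₛ Stream'.const x)
    rw [omegaPartial_append] at this
    cases this
  · have := h (v ++ₛ Stream'.const x)
    rw [omegaPartial_append] at this
    cases this
  -- The domain determines the word on the right, the range the word on the left, and the action of
  -- the group element on a finite word `w` is read off from the image of an infinite word beginning
  -- with `v ++ w`.
  · have hv : v = v' := by
      apply eq_of_cylinder_eq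
      intro ξ
      have := h ξ
      simp only [omegaPartial] at this
      split_ifs at this <;> simp_all
    subst hv
    have h1 := prefix_range h
    have h2 := prefix_range fun ξ => (h ξ).symm
    have hu : u' = u := h1.eq_of_length (le_antisymm h1.length_le h2.length_le)
    subst hu
    congr 1
    apply faithful (X := X)
    intro w
    have h3 := h (v ++ₛ (w ++ₛ Stream'.const x))
    rw [omegaPartial_append, omegaPartial_append, omegaAct_append, omegaAct_append] at h3
    have h4 := congrArg (fun ξ => (Stream'.drop u'.length ξ).take w.length) (Option.some.inj h3)
    simp only [Stream'.drop_append_stream] at h4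
    rw [← length_smul g w, take_append_aux, length_smul, ← length_smul g' w,
      take_append_aux] at h4
    exact h4

theorem omegaPartial_ne_none {s : InvSemi G X} {ξ : Stream' X} (h : omegaPartial s ξ ≠ none) :
    s ≠ 0 := by
  rintro rfl
  exact h rfl

/-- Passes from pointwise agreement on a cylinder to an identity in `S`: both products are undefined
off the cylinder, so faithfulness applies. -/
theorem mul_idem_eq [Nontrivial X] {s t : InvSemi G X} {w : List X}
    (h : ∀ ξ, ξ.take w.length = w → omegaPartial s ξ = omegaPartial t ξ) :
    s * idem G w = t * idem G w := by
  apply eq_of_omegaPartial_eq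
  intro ξ
  by_cases hξ : ξ.take w.length = w
  · rw [omegaPartial_mul_idem s hξ, omegaPartial_mul_idem t hξ, h ξ hξ]
  · rw [omegaPartial_mul, omegaPartial_mul, omegaPartial_idem_of_ne hξ]
    rfl

/-! ### Separating finitely many elements of `S` on a small cylinder -/

/-- The elements `s` and `t` of `S` agree on the cylinder of `w`, or differ everywhere on it. -/
def Separated (w : List X) (s t : InvSemi G X) : Prop :=
  s * idem G w = t * idem G w ∨
    ∀ ξ, ξ.take w.length = w → omegaPartial s ξ ≠ omegaPartial t ξ

theorem Separated.mono {u w : List X} (h : u <+: w) {s t : InvSemi G X} (hs : Separated u s t) :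
    Separated w s t := by
  rcases hs with hs | hs
  · left
    obtain ⟨z, rfl⟩ := h
    rw [← idem_mul_idem_append, ← mul_assoc, hs, mul_assoc]
  · exact Or.inr fun ξ hξ => hs ξ (take_eq_of_prefix h hξ)

/-- If the values differ at some `ξ`, they already differ in definedness or in a finite prefix, and
by continuity this persists on a cylinder around `ξ`. -/
theorem exists_separated [Nontrivial X] (u : List X) (s t : InvSemi G X) :
    ∃ w, u <+: w ∧ Separated w s t := by
  by_cases h : ∀ ξ, ξ.take u.length = u → omegaPartial s ξ = omegaPartial t ξ
  · exact ⟨u, List.prefix_rfl, Or.inl (mul_idem_eq h)⟩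
  · push Not at h
    obtain ⟨ξ, hξ, hne⟩ := h
    obtain ⟨n, hn⟩ := exists_take_omegaPartial_ne hne
    obtain ⟨N, hN⟩ := exists_take_omegaPartial s n
    obtain ⟨M, hM⟩ := exists_take_omegaPartial t n
    refine ⟨ξ.take (u.length + (N + M)), prefix_take hξ (by omega), Or.inr fun ζ hζ heq => hn ?_⟩
    rw [Stream'.length_take] at hζ
    rw [← hN ξ ζ (take_eq_take_of_le (by omega) hζ), ← hM ξ ζ (take_eq_take_of_le (by omega) hζ),
      heq]

theorem exists_forall_separated [Nontrivial X] (u : List X) (L : List (InvSemi G X × InvSemi G X)) :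
    ∃ w, u <+: w ∧ ∀ p ∈ L, Separated w p.1 p.2 := by
  induction L with
  | nil => exact ⟨u, List.prefix_rfl, by simp⟩
  | cons p L ih =>
    obtain ⟨w, hw, h⟩ := ih
    obtain ⟨w', hw', h'⟩ := exists_separated w p.1 p.2
    refine ⟨w', hw.trans hw', fun q hq => ?_⟩
    rcases List.mem_cons.1 hq with rfl | hq
    · exact h'
    · exact (h q hq).mono hw'

theorem exists_finset_separated [Nontrivial X] (u : List X) (T : Finset (InvSemi G X)) :
    ∃ w, u <+: w ∧ ∀ s ∈ T, ∀ t ∈ T, Separated w s t := by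
  obtain ⟨w, hw, h⟩ := exists_forall_separated u (T ×ˢ T).toList
  exact ⟨w, hw, fun s hs t ht => h (s, t) (by simp [hs, ht])⟩

/-- Near an infinite word `ξ`, the elements of a finite subset of `S` that map `ξ` to `η` are
those whose values have a given long prefix of `η`. -/
theorem exists_take_iff (T : Finset (InvSemi G X)) (ξ η : Stream' X) (m : ℕ) : ∃ n, ∃ N ≥ m,
    ∀ s ∈ T, ∀ ζ : Stream' X, ζ.take N = ξ.take N →
      ((omegaPartial s ζ).map (Stream'.take n) = some (η.take n) ↔
        omegaPartial s ξ = some η) := by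
  classical
  -- First `n` is chosen so that a prefix of length `n` tells `η` from the finitely many other
  -- values at `ξ`; then `N` comes from continuity.
  have h1 : ∃ n, ∀ s ∈ T, (omegaPartial s ξ).map (Stream'.take n) = some (η.take n) →
      omegaPartial s ξ = some η := by
    induction T using Finset.induction_on with
    | empty => exact ⟨0, by simp⟩
    | insert s T _ ih =>
      obtain ⟨n, hn⟩ := ih
      have : ∃ k, (omegaPartial s ξ).map (Stream'.take k) = some (η.take k) →
          omegaPartial s ξ = some η := by
        by_cases h : omegaPartial s ξ = some η
        · exact ⟨0, fun _ => h⟩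
        · obtain ⟨k, hk⟩ := exists_take_omegaPartial_ne h
          exact ⟨k, fun h' => absurd h' hk⟩
      obtain ⟨k, hk⟩ := this
      have mono : ∀ {i j : ℕ} {a : Option (Stream' X)}, i ≤ j →
          a.map (Stream'.take j) = some (η.take j) → a.map (Stream'.take i) = some (η.take i) := by
        intro i j a hij h
        rw [Option.map_eq_some_iff] at h ⊢
        obtain ⟨b, hb, h⟩ := h
        exact ⟨b, hb, take_eq_take_of_le hij h⟩
      refine ⟨n + k, fun t ht h => ?_⟩
      rcases Finset.mem_insert.1 ht with rfl | ht
      · exact hk (mono (by omega) h)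
      · exact hn t ht (mono (by omega) h)
  obtain ⟨n, hn⟩ := h1
  choose N hN using fun s : InvSemi G X => exists_take_omegaPartial s n
  refine ⟨n, m + T.sup N, by omega, fun s hs ζ hζ => ?_⟩
  rw [hN s ξ ζ (take_eq_take_of_le (le_add_left (Finset.le_sup hs)) hζ)]
  exact ⟨hn s hs, fun h => by rw [h]; rfl⟩

end Cylinders

/-! ### The kernel of the representation of the contracted algebra -/

section ContractedSpan

variable {K S : Type*} [Field K] [MonoidWithZero S]

variable (K) in
theorem ofS_mul (s t : S) : ofS K (s * t) = ofS K s * ofS K t := by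
  simp only [ofS, map_mul]

variable (K S) in
/-- The homomorphism from `S` to `K₀S`. -/
noncomputable def ofHom : S →*₀ ContractedAlgebra K S where
  toFun := ofS K
  map_zero' := by
    change Ideal.Quotient.mk (zeroIdeal K S) _ = 0
    rw [Ideal.Quotient.eq_zero_iff_mem]
    intro s hs
    simp [Ne.symm hs]
  map_one' := by simp only [ofS, map_one]
  map_mul' := ofS_mul K

theorem ofS_zero : ofS K (0 : S) = 0 := map_zero (ofHom K S)

theorem ofS_one : ofS K (1 : S) = 1 := map_one (ofHom K S)

/-- Having `0 ∈ T` costs nothing, and lets "undefined at `ξ`" be treated as "agrees at `ξ` with an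
element of `T`". -/
theorem exists_eq_sum (a : ContractedAlgebra K S) :
    ∃ (T : Finset S) (c : S → K), 0 ∈ T ∧ a = ∑ s ∈ T, c s • ofS K s := by
  classical
  have ha : a ∈ Submodule.span K (Set.range (ofS K : S → ContractedAlgebra K S)) := by
    obtain ⟨b, rfl⟩ := Ideal.Quotient.mkₐ_surjective K (zeroIdeal K S) a
    induction b using MonoidAlgebra.induction_on with
    | of s => exact Submodule.subset_span ⟨s, rfl⟩
    | add x y hx hy => rw [map_add]; exact add_mem hx hy
    | smul r x hx => rw [map_smul]; exact Submodule.smul_mem _ r hx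
  obtain ⟨c, rfl⟩ := Finsupp.mem_span_range_iff_exists_finsupp.1 ha
  refine ⟨insert 0 c.support, c, Finset.mem_insert_self _ _, ?_⟩
  exact Finset.sum_subset (Finset.subset_insert _ _) (by
    intro s _ hs
    simp [Finsupp.notMem_support_iff.1 hs])

theorem algHom_ext_ofS {A : Type*} [Semiring A] [Algebra K A]
    {f g : ContractedAlgebra K S →ₐ[K] A} (h : ∀ s, f (ofS K s) = g (ofS K s)) : f = g := by
  ext a
  obtain ⟨T, c, -, rfl⟩ := exists_eq_sum a
  simp [h]

end ContractedSpan

section Kernel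

variable {K G X : Type*} [Field K] [Group G] [SelfSimilarGroup G X]

theorem omegaOp_single_of_none {s : InvSemi G X} {ξ : Stream' X} (h : omegaPartial s ξ = none) :
    omegaOp K s (Finsupp.single ξ 1) = 0 := by
  rw [omegaOp_single, h]
  rfl

theorem omegaOp_single_of_some {s : InvSemi G X} {ξ η : Stream' X}
    (h : omegaPartial s ξ = some η) :
    omegaOp K s (Finsupp.single ξ 1) = Finsupp.single η 1 := by
  rw [omegaOp_single, h]
  rfl

theorem omegaRep_sum (T : Finset (InvSemi G X)) (c : InvSemi G X → K) (x : OmegaSpace K X) :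
    omegaRep K G X (∑ s ∈ T, c s • ofS K s) x = ∑ s ∈ T, c s • omegaOp K s x := by
  simp [omegaRep_ofS]

/-- If the elements of `T` are separated on the cylinder of `w`, then `s w w*` can be recovered
linearly from `s (ξ)` for `s ∈ T` and `ξ` in that cylinder. -/
theorem exists_linearMap_eq_ofS_mul_idem (T : Finset (InvSemi G X)) (h0 : 0 ∈ T) {w : List X}
    (hT : ∀ s ∈ T, ∀ t ∈ T, Separated w s t) {ξ : Stream' X} (hξ : ξ.take w.length = w) :
    ∃ Φ : OmegaSpace K X →ₗ[K] ContractedAlgebra K (InvSemi G X),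
      ∀ s ∈ T, Φ (omegaOp K s (Finsupp.single ξ 1)) = ofS K (s * idem G w) := by
  classical
  -- By separation the value at the single point `ξ` determines `s * idem G w`, so the choice of
  -- preimage below is harmless.
  have key : ∀ s ∈ T, ∀ t ∈ T, omegaPartial s ξ = omegaPartial t ξ →
      s * idem G w = t * idem G w := fun s hs t ht h =>
    (hT s hs t ht).resolve_right fun h' => h' ξ hξ h
  refine ⟨Finsupp.linearCombination K fun η =>
    if h : ∃ s ∈ T, omegaPartial s ξ = some η then ofS K (h.choose * idem G w) else 0, ?_⟩
  intro s hs
  cases h : omegaPartial s ξ with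
  | none =>
    rw [omegaOp_single_of_none h, map_zero, key s hs 0 h0 h, zero_mul, ofS_zero]
  | some η =>
    have hex : ∃ s ∈ T, omegaPartial s ξ = some η := ⟨s, hs, h⟩
    rw [omegaOp_single_of_some h, Finsupp.linearCombination_single, one_smul, dif_pos hex,
      key _ hex.choose_spec.1 s hs (hex.choose_spec.2.trans h.symm)]

theorem exists_linearMap_eq_mul_ofS_idem (T : Finset (InvSemi G X)) (h0 : 0 ∈ T)
    (c : InvSemi G X → K) {w : List X}
    (hT : ∀ s ∈ T, ∀ t ∈ T, Separated w s t) {ξ : Stream' X} (hξ : ξ.take w.length = w) :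
    ∃ Φ : OmegaSpace K X →ₗ[K] ContractedAlgebra K (InvSemi G X),
      Φ (omegaRep K G X (∑ s ∈ T, c s • ofS K s) (Finsupp.single ξ 1)) =
        (∑ s ∈ T, c s • ofS K s) * ofS K (idem G w) := by
  obtain ⟨Φ, hΦ⟩ := exists_linearMap_eq_ofS_mul_idem (K := K) T h0 hT hξ
  refine ⟨Φ, ?_⟩
  rw [omegaRep_sum, map_sum, Finset.sum_mul]
  refine Finset.sum_congr rfl fun s hs => ?_
  rw [map_smul, hΦ s hs, ofS_mul, smul_mul_assoc]

/-- On a separated cylinder below the given idempotent, `a ww*` is a linear image of `a ξ = 0`. -/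
theorem mem_singularIdeal_of_omegaRep_eq_zero [Nontrivial X]
    {a : ContractedAlgebra K (InvSemi G X)}
    (ha : omegaRep K G X a = 0) : a ∈ singularIdeal K (InvSemi G X) := by
  obtain ⟨x⟩ : Nonempty X := inferInstance
  intro e he h0
  obtain ⟨u, rfl⟩ := exists_eq_idem he h0
  obtain ⟨T, c, hT, rfl⟩ := exists_eq_sum a
  obtain ⟨w, ⟨z, rfl⟩, hsep⟩ := exists_finset_separated u T
  refine ⟨idem G (u ++ z), isIdempotentElem_idem _, idem_ne_zero _, idem_append_mul_idem _ _, ?_⟩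
  obtain ⟨Φ, hΦ⟩ := exists_linearMap_eq_mul_ofS_idem T hT c hsep
    (take_append_aux (u ++ z) (Stream'.const x))
  rw [← hΦ, ha, LinearMap.zero_apply, map_zero]

theorem omegaRep_single_apply (T : Finset (InvSemi G X)) (c : InvSemi G X → K)
    (ξ η : Stream' X) [DecidablePred fun s : InvSemi G X => omegaPartial s ξ = some η] :
    omegaRep K G X (∑ s ∈ T, c s • ofS K s) (Finsupp.single ξ 1) η =
      ∑ s ∈ T with omegaPartial s ξ = some η, c s := by
  classical
  rw [omegaRep_sum, Finsupp.finsetSum_apply, Finset.sum_filter]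
  refine Finset.sum_congr rfl fun s _ => ?_
  rcases Option.eq_none_or_eq_some (omegaPartial s ξ) with h | ⟨ζ, h⟩
  · simp [omegaOp_single_of_none h, h]
  · simp [omegaOp_single_of_some h, h, Finsupp.single_apply]

theorem omegaRep_eq_zero_of_mem_singularIdeal
    {a : ContractedAlgebra K (InvSemi G X)}
    (ha : a ∈ singularIdeal K (InvSemi G X)) : omegaRep K G X a = 0 := by
  classical
  obtain ⟨T, c, -, rfl⟩ := exists_eq_sum a
  apply Finsupp.lhom_ext'
  intro ξ
  ext η
  simp only [LinearMap.comp_apply, Finsupp.lsingle_apply, LinearMap.zero_apply,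
    Finsupp.coe_zero, Pi.zero_apply]
  rw [omegaRep_single_apply]
  obtain ⟨n, N, -, hN⟩ := exists_take_iff T ξ η 0
  obtain ⟨f, hf, hf0, hfe, haf⟩ := ha (idem G (ξ.take N)) (isIdempotentElem_idem _)
    (idem_ne_zero _)
  obtain ⟨w, rfl⟩ := exists_eq_idem hf hf0
  -- Any infinite word with prefix `w` would do; `ξ` only fills the tail.
  set ζ : Stream' X := w ++ₛ ξ with hζdef
  have hζw : ζ.take w.length = w := take_append_aux _ _
  have hζ : ζ.take N = ξ.take N := by
    have := take_eq_of_prefix (prefix_of_idem_mul_idem hfe) hζw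
    rwa [Stream'.length_take] at this
  have h1 : omegaRep K G X (∑ s ∈ T, c s • ofS K s) (Finsupp.single ζ 1) = 0 := by
    have h2 : omegaRep K G X (ofS K (idem G w)) (Finsupp.single ζ 1) = Finsupp.single ζ 1 := by
      rw [omegaRep_ofS, omegaOp_single_of_some (omegaPartial_idem hζw)]
    rw [← h2, ← Module.End.mul_apply, ← map_mul, haf, map_zero, LinearMap.zero_apply]
  -- This functional adds up the coefficients of all words sharing the prefix `η.take n`. By the
  -- choice of `n` and `N` its value on `a ζ` is the coefficient of `η` in `a ξ`.
  have h3 := congrArg (Finsupp.linearCombination K fun θ : Stream' X =>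
    if θ.take n = η.take n then (1 : K) else 0) h1
  rw [omegaRep_sum, map_sum, map_zero] at h3
  rw [← h3, Finset.sum_filter]
  refine Finset.sum_congr rfl fun s hs => ?_
  rw [map_smul, ← if_congr (hN s hs ζ hζ) rfl rfl]
  cases h : omegaPartial s ζ with
  | none => simp [omegaOp_single_of_none h]
  | some θ => simp [omegaOp_single_of_some h]

theorem omegaRep_eq_zero_iff [Nontrivial X] {a : ContractedAlgebra K (InvSemi G X)} :
    omegaRep K G X a = 0 ↔ a ∈ singularIdeal K (InvSemi G X) :=
  ⟨mem_singularIdeal_of_omegaRep_eq_zero, omegaRep_eq_zero_of_mem_singularIdeal⟩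

end Kernel

/-! ### The Nekrashevych algebra as a quotient by the tight ideal -/

section Products

variable {R : Type*} [Ring R]

/-- The factors need not commute with each other: `p` is moved through the product to the factor
that it annihilates. -/
theorem list_prod_mul_eq_zero {L : List R} {p l : R} (hc : ∀ x ∈ L, Commute x p) (hl : l ∈ L)
    (h : l * p = 0) : L.prod * p = 0 := by
  induction L with
  | nil => simp at hl
  | cons x L ih =>
    rw [List.prod_cons, mul_assoc]
    rcases List.mem_cons.1 hl with rfl | hl
    · have : Commute L.prod p :=
        Commute.list_prod_left L p fun y hy => hc y (List.mem_cons_of_mem _ hy)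
      rw [this.eq, ← mul_assoc, h, zero_mul]
    · rw [ih (fun y hy => hc y (List.mem_cons_of_mem _ hy)) hl, mul_zero]

/-- Orthogonality kills all terms of degree at least two in the expansion. -/
theorem list_prod_one_sub {ι : Type*} {L : List ι} (hL : L.Nodup) {p : ι → R}
    (hp : ∀ i j, i ≠ j → p i * p j = 0) :
    (L.map fun i => 1 - p i).prod = 1 - (L.map p).sum := by
  induction L with
  | nil => simp
  | cons i L ih =>
    have h : p i * (L.map p).sum = 0 := by
      rw [← List.sum_map_mul_left]
      apply List.sum_eq_zero
      intro y hy
      obtain ⟨j, hj, rfl⟩ := List.mem_map.1 hy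
      exact hp i j (by rintro rfl; exact (List.nodup_cons.1 hL).1 hj)
    rw [List.map_cons, List.prod_cons, ih (List.nodup_cons.1 hL).2, List.map_cons, List.sum_cons,
      sub_mul, mul_sub, one_mul, mul_sub, h]
    noncomm_ring

end Products

section Generators

variable {G X : Type*} [Group G] [SelfSimilarGroup G X]

theorem mk_eq_mul_mul (u : List X) (g : G) (v : List X) :
    InvSemi.mk u g v = InvSemi.mk u 1 [] * InvSemi.mk [] g [] * InvSemi.mk [] 1 v := by
  simp [mk_mul_mk_nil, smul_nil, secW]

theorem map_mk_cons {A : Type*} [Semiring A] (h : InvSemi G X →*₀ A) (x : X) (w : List X) :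
    h (.mk (x :: w) 1 []) = h (.mk [x] 1 []) * h (.mk w 1 []) := by
  rw [← map_mul, mk_mul_mk_nil]
  simp [secW_one]

theorem map_mk_cons_star {A : Type*} [Semiring A] (h : InvSemi G X →*₀ A) (x : X) (w : List X) :
    h (.mk [] 1 (x :: w)) = h (.mk [] 1 w) * h (.mk [] 1 [x]) := by
  rw [← map_mul, mk_nil_mul_mk]
  simp [secW_one]

theorem commute_idem (u v : List X) : Commute (idem G u) (idem G v) := by
  by_cases h1 : u <+: v
  · obtain ⟨z, rfl⟩ := h1
    exact (idem_mul_idem_append u z).trans (idem_append_mul_idem u z).symm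
  by_cases h2 : v <+: u
  · obtain ⟨z, rfl⟩ := h2
    exact (idem_append_mul_idem v z).trans (idem_mul_idem_append v z).symm
  · exact (mk_mul_mk_incomp h1 h2).trans (mk_mul_mk_incomp h2 h1).symm

theorem exists_length_bound {G X : Type*} [Group G] (F : List (InvSemi G X)) :
    ∃ n, ∀ v, idem G v ∈ F → v.length ≤ n := by
  induction F with
  | nil => exact ⟨0, by simp⟩
  | cons f F ih =>
    obtain ⟨n, hn⟩ := ih
    rcases f with _ | ⟨u, g, v⟩
    · exact ⟨n, fun w hw => hn w ((List.mem_cons.1 hw).resolve_left nofun)⟩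
    · refine ⟨n + v.length, fun w hw => ?_⟩
      rcases List.mem_cons.1 hw with h | h
      · injection h with _ _ h
        rw [h]
        omega
      · exact (hn w h).trans (Nat.le_add_right _ _)

end Generators

section Quotient

variable {K G X : Type*} [Field K] [Group G] [SelfSimilarGroup G X] [Fintype X]

/-- A homomorphism from the Nekrashevych algebra that extends a homomorphism from `S` on the
generators extends it on `S`. -/
theorem map_nekOf {A : Type*} [Semiring A] [Algebra K A] (h : InvSemi G X →*₀ A)
    (f : NekAlgebra K G X →ₐ[K] A) (hL : ∀ x, f (nekL K x) = h (.mk [x] 1 []))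
    (hLs : ∀ x, f (nekLs K x) = h (.mk [] 1 [x])) (hE : ∀ g, f (nekE K g) = h (.mk [] g []))
    (s : InvSemi G X) : f (nekOf K s) = h s := by
  have h1 : h (.mk [] 1 []) = 1 := map_one h
  have hW : ∀ w, f (nekW K G w) = h (.mk w 1 []) := by
    intro w
    induction w with
    | nil => rw [nekW_nil, map_one, h1]
    | cons x w ih => rw [nekW_cons, map_mul, ih, hL, map_mk_cons h x w]
  have hWs : ∀ w, f (nekWs K G w) = h (.mk [] 1 w) := by
    intro w
    induction w with
    | nil => rw [nekWs_nil, map_one, h1]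
    | cons x w ih => rw [nekWs_cons, map_mul, ih, hLs, map_mk_cons_star h x w]
  rcases s with _ | ⟨u, g, v⟩
  · exact (map_zero f).trans (map_zero h).symm
  · rw [nekOf, map_mul, map_mul, hW, hWs, hE, mk_eq_mul_mul u g v, map_mul, map_mul]

theorem nekRep_nekOf (s : InvSemi G X) : nekRep K G X (nekOf K s) = omegaOp K s := by
  apply map_nekOf (omegaHom K G X) (nekRep K G X)
  all_goals
    intro x
    simp only [nekRep, nekL, nekLs, nekE, RingQuot.liftAlgHom_mkAlgHom_apply, freeRep,
      FreeAlgebra.lift_ι_apply, NekGen.toInv]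

theorem nekRep_comp_nekQuot : (nekRep K G X).comp (nekQuot K G X) = omegaRep K G X :=
  algHom_ext_ofS fun s => by
    rw [AlgHom.comp_apply, nekQuot_ofS, nekRep_nekOf, omegaRep_ofS]

theorem nekRep_nekQuot (a : ContractedAlgebra K (InvSemi G X)) :
    nekRep K G X (nekQuot K G X a) = omegaRep K G X a :=
  DFunLike.congr_fun nekRep_comp_nekQuot a

theorem mkAlgHom_ι (y : NekGen G X) :
    RingQuot.mkAlgHom K (NekRel K G X) (FreeAlgebra.ι K y) = nekOf K y.toInv := by
  cases y with
  | letter x => simp [NekGen.toInv, nekOf, nekE_one, nekW, nekWs, nekL]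
  | letterStar x => simp [NekGen.toInv, nekOf, nekE_one, nekW, nekWs, nekLs]
  | elt g => simp [NekGen.toInv, nekOf, nekW, nekWs, nekE]
  | eltStar g =>
    simpa [NekGen.toInv, nekOf, nekW, nekWs, nekE] using
      RingQuot.mkAlgHom_rel K (NekRel.inv (K := K) (X := X) g)

theorem nekQuot_surjective : Function.Surjective (nekQuot K G X) := by
  intro b
  obtain ⟨b, rfl⟩ := RingQuot.mkAlgHom_surjective K (NekRel K G X) b
  change _ ∈ (nekQuot K G X).range
  induction b using FreeAlgebra.induction with
  | grade0 r => rw [AlgHom.commutes]; exact Subalgebra.algebraMap_mem _ r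
  | grade1 y => rw [mkAlgHom_ι]; exact ⟨ofS K y.toInv, nekQuot_ofS K _⟩
  | mul a b ha hb => rw [map_mul]; exact mul_mem ha hb
  | add a b ha hb => rw [map_add]; exact add_mem ha hb

theorem nekOf_idem (w : List X) : nekOf K (idem G w) = nekW K G w * nekWs K G w := by
  rw [idem, nekOf, nekE_one, mul_one]

theorem sum_nekL_nekLs : ∑ x : X, nekL K x * nekLs K x = (1 : NekAlgebra K G X) := by
  simpa [nekLs, nekL] using RingQuot.mkAlgHom_rel K (NekRel.ck2 (K := K) (G := G) (X := X))

/-- The relation `∑ xx* = 1`, multiplied by `u` on the left and `u*` on the right. -/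
theorem sum_nekOf_idem (u : List X) :
    ∑ x : X, nekOf K (idem G (u ++ [x])) = nekOf K (idem G u) := by
  have h : ∀ x : X, nekOf K (idem G (u ++ [x])) =
      nekW K G u * (nekL K x * nekLs K x) * nekWs K G u := by
    intro x
    rw [nekOf_idem, nekW_append, nekWs_append]
    simp [nekW, nekWs, mul_assoc]
  simp only [h]
  rw [← Finset.sum_mul, ← Finset.mul_sum, sum_nekL_nekLs, mul_one, nekOf_idem]

/-- Vanishing on a cylinder may be tested on its subcylinders of depth `n`, whose idempotents sum to
that of the cylinder. -/
theorem mul_nekOf_idem_eq_zero {b : NekAlgebra K G X} (n : ℕ) (u : List X)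
    (h : ∀ z : List X, z.length = n → b * nekOf K (idem G (u ++ z)) = 0) :
    b * nekOf K (idem G u) = 0 := by
  induction n generalizing u with
  | zero => simpa using h [] rfl
  | succ n ih =>
    rw [← sum_nekOf_idem, Finset.mul_sum]
    refine Finset.sum_eq_zero fun x _ => ih _ fun z hz => ?_
    have := h (x :: z) (by simp [hz])
    rwa [← List.append_cons]

theorem commute_nekOf {e f : InvSemi G X} (he : IsIdempotentElem e) (hf : IsIdempotentElem f) :
    Commute (nekOf K e) (nekOf K f) := by
  have key : Commute e f := by
    by_cases h : e = 0
    · exact h ▸ Commute.zero_left f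
    by_cases h' : f = 0
    · exact h' ▸ Commute.zero_right e
    obtain ⟨u, rfl⟩ := exists_eq_idem he h
    obtain ⟨v, rfl⟩ := exists_eq_idem hf h'
    exact commute_idem u v
  exact key.map (nekHom K G X)

/-- Once `n` bounds the words in `F`, each subcylinder of depth `n` lies inside some cylinder of the
cover, and the factor belonging to that member annihilates it. -/
theorem nekQuot_tight {e : InvSemi G X} {F : List (InvSemi G X)} (he : IsIdempotentElem e)
    (hF : IsCover F e) :
    nekQuot K G X (ofS K e * (F.map fun f => ofS K e - ofS K f).prod) = 0 := by
  by_cases h0 : e = 0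
  · rw [h0, ofS_zero, zero_mul, map_zero]
  obtain ⟨u, rfl⟩ := exists_eq_idem he h0
  rw [map_mul, map_list_prod, List.map_map, nekQuot_ofS]
  have hL : (F.map (nekQuot K G X ∘ fun f => ofS K (idem G u) - ofS K f)) =
      F.map fun f => nekOf K (idem G u) - nekOf K f := by
    simp [Function.comp_def, nekQuot_ofS]
  rw [hL]
  have hc : ∀ w, ∀ x ∈ F.map fun f => nekOf K (idem G u) - nekOf K f,
      Commute x (nekOf K (idem G w)) := by
    intro w x hx
    obtain ⟨f, hf, rfl⟩ := List.mem_map.1 hx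
    exact (commute_nekOf he (isIdempotentElem_idem w)).sub_left
      (commute_nekOf (hF.idempotent f hf) (isIdempotentElem_idem w))
  -- The idempotent is moved to the right of the product, where it can be split into subcylinders.
  rw [← (Commute.list_prod_left _ _ (hc u)).eq]
  obtain ⟨n, hn⟩ := exists_length_bound F
  refine mul_nekOf_idem_eq_zero n u fun z hz => ?_
  obtain ⟨f, hf, hne⟩ := hF.meets (idem G (u ++ z)) (isIdempotentElem_idem _) (idem_ne_zero _)
    (idem_append_mul_idem u z)
  obtain ⟨v, rfl⟩ := exists_eq_idem (hF.idempotent f hf) (by rintro rfl; exact hne (mul_zero _))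
  -- A nonzero meet makes the words comparable, and `v.length ≤ n ≤ (u ++ z).length` decides the
  -- direction.
  obtain ⟨y, hy⟩ : v <+: u ++ z := by
    rcases prefix_or_prefix_of_mul_ne_zero hne with h | h
    · have hl := h.length_le
      have := hn v hf
      simp only [List.length_append] at hl
      exact (h.eq_of_length (by simp only [List.length_append]; omega)) ▸ List.prefix_rfl
    · exact h
  apply list_prod_mul_eq_zero (hc _) (List.mem_map_of_mem hf)
  rw [sub_mul, ← nekOf_mul, ← nekOf_mul, idem_mul_idem_append, ← hy, idem_mul_idem_append,
    sub_self]

/-- A homomorphism from `S` with `∑ x x* ↦ 1` induces a homomorphism from the Nekrashevych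
algebra. -/
theorem exists_nekAlgebra_lift {A : Type*} [Semiring A] [Algebra K A] (h : InvSemi G X →*₀ A)
    (hsum : ∑ x : X, h (idem G [x]) = 1) :
    ∃ f : NekAlgebra K G X →ₐ[K] A, ∀ s, f (nekOf K s) = h s := by
  have hrel : ∀ ⦃a b : FreeAlgebra K (NekGen G X)⦄, NekRel K G X a b →
      FreeAlgebra.lift K (fun y => h y.toInv) a = FreeAlgebra.lift K (fun y => h y.toInv) b := by
    intro a b hab
    have h1 : h (.mk [] 1 []) = 1 := map_one h
    induction hab with
    | one | one_star => simp [NekGen.toInv, h1]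
    | inv g | inv_star g => simp [NekGen.toInv]
    | mul g g' | mul_star g g' | ss g x | ss_star g x =>
      simp only [map_mul, FreeAlgebra.lift_ι_apply, NekGen.toInv]
      simp [← map_mul, mk_mul_mk_nil, mk_nil_mul_mk, smul_nil, secW, smul_singleton]
    | ck1 x =>
      have := mk_mul_mk_left [] (1 : G) [x] [] 1 []
      simp only [List.append_nil, smul_nil, secW, mul_one] at this
      simp only [map_mul, FreeAlgebra.lift_ι_apply, NekGen.toInv]
      rw [← map_mul, this, map_one, h1]
    | ck1_ne x y hxy =>
      have : InvSemi.mk [] (1 : G) [y] * InvSemi.mk [x] 1 [] = 0 :=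
        mk_mul_mk_incomp (by simpa using Ne.symm hxy) (by simpa using hxy)
      simp only [map_mul, FreeAlgebra.lift_ι_apply, NekGen.toInv]
      rw [← map_mul, this, map_zero, map_zero]
    | ck2 =>
      have h2 : ∀ x : X, InvSemi.mk [x] (1 : G) [] * InvSemi.mk [] 1 [x] = idem G [x] := by
        intro x
        simp [mk_mul_mk_nil, secW, idem]
      simp only [map_sum, map_mul, FreeAlgebra.lift_ι_apply, NekGen.toInv, map_one]
      simp only [← map_mul, h2, hsum]
  refine ⟨RingQuot.liftAlgHom K ⟨_, hrel⟩, map_nekOf h _ ?_ ?_ ?_⟩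
  all_goals
    intro x
    simp only [nekL, nekLs, nekE, RingQuot.liftAlgHom_mkAlgHom_apply,
      FreeAlgebra.lift_ι_apply, NekGen.toInv]

/-- A nonempty word lies below its first letter; the empty word meets every letter, which is where
`Nonempty X` enters. -/
theorem isCover_letters [Nonempty X] :
    IsCover ((Finset.univ : Finset X).toList.map fun x => idem G [x]) (1 : InvSemi G X) where
  idempotent f hf := by
    obtain ⟨x, -, rfl⟩ := List.mem_map.1 hf
    exact isIdempotentElem_idem _
  le f _ := mul_one f
  meets f hf h0 _ := by
    obtain ⟨w, rfl⟩ := exists_eq_idem hf h0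
    cases w with
    | nil =>
      obtain ⟨x⟩ := ‹Nonempty X›
      refine ⟨idem G [x], List.mem_map_of_mem (by simp), ?_⟩
      exact (idem_mul_idem_append (G := G) [] [x]).trans_ne (idem_ne_zero _)
    | cons x w =>
      refine ⟨idem G [x], List.mem_map_of_mem (by simp), ?_⟩
      have := idem_append_mul_idem (G := G) [x] w
      rw [List.singleton_append] at this
      rw [this]
      exact idem_ne_zero _

end Quotient

/-- The quotient by `I`, presented only through its map and kernel; nothing else about it is needed.
-/
theorem exists_algHom_eq_zero_iff.{u} (K : Type*) {R : Type u} [CommRing K] [Ring R]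
    [Algebra K R] (I : TwoSidedIdeal R) : ∃ (A : Type u) (_ : Ring A) (_ : Algebra K A) (π : R →ₐ[K] A),
      ∀ a, π a = 0 ↔ a ∈ I :=
  ⟨R ⧸ I.asIdeal, inferInstance, inferInstance, Ideal.Quotient.mkₐ K I.asIdeal,
    fun _ => Ideal.Quotient.eq_zero_iff_mem.trans TwoSidedIdeal.mem_asIdeal⟩

/-! ### Compressing non-singular elements to elements of `S` -/

section Compression

variable {K G X : Type*} [Field K] [Group G] [SelfSimilarGroup G X]

/-- `(g⁻¹ u*) (u g v*) v = 1`. -/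
theorem exists_mul_mul_eq_one {s : InvSemi G X} (hs : s ≠ 0) : ∃ t r, t * s * r = 1 := by
  rcases s with _ | ⟨u, g, v⟩
  · exact absurd rfl hs
  · refine ⟨.mk [] g⁻¹ u, .mk v 1 [], ?_⟩
    have h1 := mk_mul_mk_left [] g⁻¹ u [] g v
    have h2 := mk_mul_mk_left [] (1 : G) v [] 1 []
    simp only [List.append_nil, smul_nil, secW, inv_mul_cancel, mul_one] at h1 h2
    rw [h1, h2]
    rfl

/-- An element of `K₀S` outside the singular ideal can be compressed to a non-zero multiple of
an element of `S`. -/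
theorem exists_mul_mul_eq_smul_ofS [Nontrivial X] {a : ContractedAlgebra K (InvSemi G X)}
    (ha : a ∉ singularIdeal K (InvSemi G X)) :
    ∃ (b c : ContractedAlgebra K (InvSemi G X)) (d : K) (s : InvSemi G X),
      d ≠ 0 ∧ s ≠ 0 ∧ b * a * c = d • ofS K s := by
  classical
  obtain ⟨x⟩ : Nonempty X := inferInstance
  obtain ⟨T, c, hT0, rfl⟩ := exists_eq_sum a
  have ha' : ∃ e : InvSemi G X, IsIdempotentElem e ∧ e ≠ 0 ∧
      ∀ f : InvSemi G X, IsIdempotentElem f → f ≠ 0 → f * e = f →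
        (∑ s ∈ T, c s • ofS K s) * ofS K f ≠ 0 := by
    by_contra! h
    exact ha h
  obtain ⟨e, he, he0, hne⟩ := ha'
  obtain ⟨u, rfl⟩ := exists_eq_idem he he0
  obtain ⟨w, ⟨z, rfl⟩, hsep⟩ := exists_finset_separated u T
  set w := u ++ z with hw
  have hξ := take_append_aux w (Stream'.const x)
  set ξ := w ++ₛ Stream'.const x
  obtain ⟨Φ, hΦ⟩ := exists_linearMap_eq_mul_ofS_idem T hT0 c hsep hξ
  -- Otherwise `Φ` would give `a ww* = 0` for an idempotent `ww*` below the one witnessing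
  -- non-singularity.
  have hne' : omegaRep K G X (∑ s ∈ T, c s • ofS K s) (Finsupp.single ξ 1) ≠ 0 := by
    intro h
    rw [h, map_zero] at hΦ
    exact hne _ (isIdempotentElem_idem _) (idem_ne_zero _) (idem_append_mul_idem _ _) hΦ.symm
  obtain ⟨η, hη⟩ := Finsupp.ne_iff.1 hne'
  rw [omegaRep_single_apply, Finsupp.coe_zero, Pi.zero_apply] at hη
  -- The bound `w.length ≤ N` keeps the cylinder of `ξ.take N` inside that of `w`, where `T` is
  -- separated.
  obtain ⟨n, N, hNw, hN⟩ := exists_take_iff T ξ η w.length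
  obtain ⟨t, ht, -⟩ := Finset.exists_ne_zero_of_sum_ne_zero hη
  obtain ⟨htT, htη⟩ := Finset.mem_filter.1 ht
  have hpre : w <+: ξ.take N := prefix_take hξ hNw
  have hξN : ξ.take (ξ.take N).length = ξ.take N := by rw [Stream'.length_take]
  -- The scalar is the coefficient of `η` in `a ξ`. The elements of `T` mapping `ξ` to `η` all
  -- restrict to the same element as `t` near `ξ`; the others are removed by the left idempotent, as
  -- their values there avoid the cylinder of `η.take n`.
  refine ⟨ofS K (idem G (η.take n)), ofS K (idem G (ξ.take N)), _,
    idem G (η.take n) * (t * idem G (ξ.take N)), hη, ?_, ?_⟩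
  · apply omegaPartial_ne_none (ξ := ξ)
    rw [omegaPartial_mul, omegaPartial_mul_idem t hξN, htη, Option.bind_some,
      omegaPartial_idem (by rw [Stream'.length_take])]
    exact Option.some_ne_none _
  · rw [Finset.mul_sum, Finset.sum_mul, Finset.sum_smul, Finset.sum_filter]
    refine Finset.sum_congr rfl fun s hs => ?_
    rw [mul_smul_comm, smul_mul_assoc, ← ofS_mul, ← ofS_mul, mul_assoc]
    split_ifs with h
    · have : s * idem G (ξ.take N) = t * idem G (ξ.take N) :=
        ((hsep s hs t htT).mono hpre).resolve_right fun h' => h' ξ hξN (h.trans htη.symm)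
      rw [this]
    · have : idem G (η.take n) * s * idem G (ξ.take N) = 0 * idem G (ξ.take N) := by
        apply mul_idem_eq
        intro ζ hζ
        rw [Stream'.length_take] at hζ
        have h1 := mt (hN s hs ζ hζ).1 h
        rw [omegaPartial_mul]
        rcases Option.eq_none_or_eq_some (omegaPartial s ζ) with h2 | ⟨θ, h2⟩
        · rw [h2]
          rfl
        · rw [h2, Option.bind_some, omegaPartial_idem_of_ne]
          · rfl
          · intro h3
            rw [Stream'.length_take] at h3
            exact h1 (by rw [h2, Option.map_some, h3])
      rw [← mul_assoc, this, zero_mul, ofS_zero, smul_zero]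

end Compression

/-! ### The kernel of the canonical map and simplicity -/

section Tight

variable {K G X : Type*} [Field K] [Group G] [SelfSimilarGroup G X] [Fintype X]

theorem one_sub_sum_mem_tightIdeal [Nonempty X] :
    1 - ∑ x : X, ofS K (idem G [x]) ∈ tightIdeal K (InvSemi G X) := by
  apply TwoSidedIdeal.subset_span
  refine ⟨1, _, IsIdempotentElem.one, isCover_letters, ?_⟩
  rw [List.map_map, ofS_one, one_mul]
  change _ = (List.map (fun x => 1 - ofS K (idem G [x])) _).prod
  rw [list_prod_one_sub (Finset.nodup_toList _), Finset.sum_map_toList]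
  intro x y hxy
  rw [← ofS_mul, idem, idem, mk_mul_mk_incomp (by simpa using hxy) (by simpa using hxy.symm)]
  exact ofS_zero

/-- Under `hπ` the restriction of `π` to `S` respects the defining relations of `𝒩`, so `π` factors
through `nekQuot`. -/
theorem eq_zero_of_nekQuot_eq_zero {A : Type*} [Ring A] [Algebra K A]
    (π : ContractedAlgebra K (InvSemi G X) →ₐ[K] A)
    (hπ : π (1 - ∑ x : X, ofS K (idem G [x])) = 0) {a : ContractedAlgebra K (InvSemi G X)}
    (ha : nekQuot K G X a = 0) : π a = 0 := by
  let h : InvSemi G X →*₀ A :=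
    { toFun := fun s => π (ofS K s)
      map_zero' := by rw [ofS_zero, map_zero]
      map_one' := by rw [ofS_one, map_one]
      map_mul' := fun s t => by rw [ofS_mul, map_mul] }
  obtain ⟨f, hf⟩ := exists_nekAlgebra_lift (K := K) h (by
    rw [map_sub, map_one, map_sum, sub_eq_zero] at hπ
    exact hπ.symm)
  have hcomp : f.comp (nekQuot K G X) = π := algHom_ext_ofS fun s => by
    rw [AlgHom.comp_apply, nekQuot_ofS, hf]
    rfl
  rw [← hcomp, AlgHom.comp_apply, ha, map_zero]

/-- For `≤`, the factorization is applied to the quotient map of `K₀S` modulo Tight; for `≥`, the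
generators of Tight are killed. -/
theorem ker_nekQuot [Nonempty X] :
    TwoSidedIdeal.ker (nekQuot K G X) = tightIdeal K (InvSemi G X) := by
  apply le_antisymm
  · intro a ha
    obtain ⟨A, _, _, π, hπ⟩ := exists_algHom_eq_zero_iff K (tightIdeal K (InvSemi G X))
    exact (hπ a).1 (eq_zero_of_nekQuot_eq_zero π ((hπ _).2 one_sub_sum_mem_tightIdeal)
      ((TwoSidedIdeal.mem_ker _).1 ha))
  · rw [tightIdeal, TwoSidedIdeal.span_le]
    rintro _ ⟨e, F, he, hF, rfl⟩
    exact (TwoSidedIdeal.mem_ker _).2 (nekQuot_tight he hF)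

theorem ker_nekRep [Nontrivial X] :
    (TwoSidedIdeal.ker (nekRep K G X) : Set (NekAlgebra K G X)) =
      nekQuot K G X '' singularIdeal K (InvSemi G X) := by
  ext b
  rw [SetLike.mem_coe, TwoSidedIdeal.mem_ker]
  constructor
  · obtain ⟨a, rfl⟩ := nekQuot_surjective b
    intro h
    rw [nekRep_nekQuot] at h
    exact ⟨a, omegaRep_eq_zero_iff.1 h, rfl⟩
  · rintro ⟨a, ha, rfl⟩
    rw [nekRep_nekQuot, omegaRep_eq_zero_iff.2 ha]

theorem isSimpleRing_nekAlgebra_iff [Nontrivial X] :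
    IsSimpleRing (NekAlgebra K G X) ↔ Function.Injective (nekRep K G X) := by
  obtain ⟨x⟩ : Nonempty X := inferInstance
  have : Nonempty (Stream' X) := ⟨Stream'.const x⟩
  have : Nontrivial (Module.End K (OmegaSpace K X)) := inferInstance
  constructor
  · intro h
    -- A ring homomorphism from a simple ring to a nontrivial ring is injective.
    exact RingHom.injective (nekRep K G X).toRingHom
  · intro h
    have : Nontrivial (NekAlgebra K G X) := by
      refine ⟨0, 1, fun h01 => ?_⟩
      have := congrArg (nekRep K G X) h01
      rw [map_zero, map_one] at this
      exact zero_ne_one this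
    refine IsSimpleRing.of_eq_bot_or_eq_top fun I => ?_
    rw [or_iff_not_imp_left]
    intro hI
    obtain ⟨b, hb, hb0⟩ : ∃ b ∈ I, b ≠ 0 := by
      by_contra! hc
      exact hI (eq_bot_iff.2 fun b hb => (TwoSidedIdeal.mem_bot _).2 (hc b hb))
    obtain ⟨a, rfl⟩ := nekQuot_surjective b
    have ha : a ∉ singularIdeal K (InvSemi G X) := by
      intro ha
      apply hb0
      apply h
      rw [nekRep_nekQuot, omegaRep_eq_zero_iff.2 ha, map_zero]
    obtain ⟨p, q, d, s, hd, hs, heq⟩ := exists_mul_mul_eq_smul_ofS ha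
    obtain ⟨t, r, htr⟩ := exists_mul_mul_eq_one hs
    rw [eq_top_iff]
    -- Since `p a q = d s` and `t s r = 1`, the ideal generated by the image of `a` contains `1`.
    have h1 : (d⁻¹ • nekQuot K G X (ofS K t * p)) * nekQuot K G X a *
        nekQuot K G X (q * ofS K r) = 1 := by
      rw [smul_mul_assoc, smul_mul_assoc, ← map_mul, ← map_mul,
        show ofS K t * p * a * (q * ofS K r) = ofS K t * (p * a * q) * ofS K r by
          simp only [mul_assoc],
        heq, mul_smul_comm, smul_mul_assoc, ← ofS_mul, ← ofS_mul, htr, map_smul, ofS_one,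
        map_one, smul_smul, inv_mul_cancel₀ hd, one_smul]
    have h1I : (1 : NekAlgebra K G X) ∈ I :=
      h1 ▸ I.mul_mem_right _ _ (I.mul_mem_left _ _ hb)
    intro y _
    simpa using I.mul_mem_left y 1 h1I

end Tight

end Nekrashevych
theorem mainTheorem3 (K G X : Type*) [Field K] [Group G] [Fintype X] [Nontrivial X]
    [Nekrashevych.SelfSimilarGroup G X] :
    -- the kernel of the representation of `K₀S` on `K X^ω` is the singular ideal
    (TwoSidedIdeal.ker (Nekrashevych.omegaRep K G X) :
        Set (Nekrashevych.ContractedAlgebra K (Nekrashevych.InvSemi G X))) =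
      Nekrashevych.singularIdeal K (Nekrashevych.InvSemi G X) ∧
    -- the canonical map from `K₀S` identifies the Nekrashevych algebra with `K₀S / Tight`,
    -- and the representation of the Nekrashevych algebra is induced by that of `K₀S`
    Function.Surjective (Nekrashevych.nekQuot K G X) ∧
    TwoSidedIdeal.ker (Nekrashevych.nekQuot K G X) =
      Nekrashevych.tightIdeal K (Nekrashevych.InvSemi G X) ∧
    (Nekrashevych.nekRep K G X).comp (Nekrashevych.nekQuot K G X) =
      Nekrashevych.omegaRep K G X ∧
    -- the kernel of the representation of the Nekrashevych algebra is `Sing / Tight`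
    (Nekrashevych.tightIdeal K (Nekrashevych.InvSemi G X) :
        Set (Nekrashevych.ContractedAlgebra K (Nekrashevych.InvSemi G X))) ⊆
      Nekrashevych.singularIdeal K (Nekrashevych.InvSemi G X) ∧
    (TwoSidedIdeal.ker (Nekrashevych.nekRep K G X) : Set (Nekrashevych.NekAlgebra K G X)) =
      Nekrashevych.nekQuot K G X '' Nekrashevych.singularIdeal K (Nekrashevych.InvSemi G X) ∧
    -- the Nekrashevych algebra is simple if and only if its representation is faithful
    (IsSimpleRing (Nekrashevych.NekAlgebra K G X) ↔
      Function.Injective (Nekrashevych.nekRep K G X)) := by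
  have hker := Nekrashevych.ker_nekQuot (K := K) (G := G) (X := X)
  refine ⟨?_, Nekrashevych.nekQuot_surjective, hker, Nekrashevych.nekRep_comp_nekQuot, ?_,
    Nekrashevych.ker_nekRep, Nekrashevych.isSimpleRing_nekAlgebra_iff⟩
  · ext a
    rw [SetLike.mem_coe, TwoSidedIdeal.mem_ker, Nekrashevych.omegaRep_eq_zero_iff]
  -- What dies in `𝒩` acts as zero, because the representation of `K₀S` factors through `𝒩`.
  · intro a ha
    rw [← hker, SetLike.mem_coe, TwoSidedIdeal.mem_ker] at ha
    rw [← Nekrashevych.omegaRep_eq_zero_iff, ← Nekrashevych.nekRep_nekQuot, ha, map_zero]
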